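/- Let $n\ge 3$, let $I\subset\mathbb R$ be an open interval, and let $f:I\to\mathbb Q_n$ be an $(n-2)$-generic immersed curve in the conformal $n$-sphere $\mathbb Q_n=\{[x^0:\dots:x^{n+1}] : \sum_{A=1}^n (x^A)^2-2x^0x^{n+1}=0\}$. Write $\langle\,,\rangle$ for the Lorentzian product $\langle x,y\rangle=\sum_{A=1}^n x^Ay^A-x^0y^{n+1}-x^{n+1}y^0$. Let $e=(e_0,\dots,e_{n+1})$ be the conformal Frenet frame of $f$ (with values in the Möbius group and $f=[e_0]$), let $s$ be the conformal arclength, and let $\mu_1,\dots,\mu_{n-1}$ be the conformal curvatures, so that $$\begin{aligned} &de_0=ds\,e_1,\quad de_1=\mu_1\,ds\,e_0+ds\,e_{n+1},\quad de_2=ds\,e_0+\mu_2\,ds\,e_3,\\ &de_k=-\mu_{k-1}\,ds\,e_{k-1}+\mu_k\,ds\,e_{k+1}\ (3\le k\le n-1),\\ &de_n=-\mu_{n-1}\,ds\,e_{n-1},\quad de_{n+1}=\mu_1\,ds\,e_1+ds\,e_2, \end{aligned}$$ with $ds>0$ and $\mu_k>0$ for $2\le k\le n-2$ ($\mu_{n-1}$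 may vanish or change sign). (a) Let $\eta$ be a smooth lift of $f$ to $\mathbb R^{n+2}\setminus\{0\}$, and let $V_j=\langle\eta,\dot\eta,\dots,\eta^{(j+1)}\rangle$ be the subspace that defines the osculating $j$-sphere. With $f$ parametrized by $s$, let $T_j(s,h)$ be the trace of $\pi\circ\tilde\pi$ on $\pi(V_j(s))$, where $\pi,\tilde\pi$ are the Lorentz-orthogonal projections of $\mathbb R^{n+2}$ onto $V_j(s+h)$ and $V_j(s)$. Then for $2\le j\le n-1$ the function $h\mapsto T_j(s,h)$ is $C^2$ near $h=0$, $\frac{\partial^2T_j}{\partial h^2}\big|_{h=0}\le 0$, and the invariant $k_j=\sqrt{-\tfrac12\frac{\partial^2T_j}{\partial h^2}\big|_{h=0}}$ satisfies $k_j=|\mu_j|$; in particular $k_j=\mu_j$ for $2\le j\le n-2$. (b) Suppose moreover that $f=[1:F:\tfrac12|F|^2]$ for a smooth immersed curve $F:I\to\mathbb R^n$ that has a Euclidean Frenet frame, with curvatures $k>0$, $\tau_j>0$ for $2\le j\le n-2$, and $\tau_{n-1}\ne 0$ everywhere. Then for $1\le i\le n-1$ the osculating $i$-sphere of $F$, that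 is the set of $x\in\mathbb R^n$ with $(1,x,\tfrac12|x|^2)\in V_i$, is a round $i$-sphere in an $(i+1)$-dimensional affine subspace. Let $c_i$ and $r_i$ be its centre and radius, and let $'$ be the derivative with respect to the Euclidean arclength $s_e$. Then $$\mu_j=\frac{r_{j-1}\,r_{j+1}\,|\tau_{j+1}|}{r_j^2\,\big[(k')^2+k^2\tau_2^2\big]^{1/4}}\qquad(2\le j\le n-2).$$ For $j=n-1$, where $r_n$ and $\tau_n$ do not exist in $\mathbb R^n$, the centre $c_{n-1}$ is smooth and the same formula holds with the product $r_n\tau_n$ replaced by the speed $|c_{n-1}'|$ of the centre of the osculating hypersphere: $$|\mu_{n-1}|=\frac{r_{n-2}\,|c_{n-1}'|}{r_{n-1}^2\,\big[(k')^2+k^2\tau_2^2\big]^{1/4}} .$$ -/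

import Mathlib

open scoped ContDiff

noncomputable section

/-- The Gram matrix of the Lorentzian product
`⟨v, w⟩ = -v⁰wⁿ⁺¹ - vⁿ⁺¹w⁰ + ∑_A v^A w^A` on `ℝ^{n+2}`, with indices `0, 1, …, n, n+1`. -/
def lorentzMatrix (n : ℕ) : Matrix (Fin (n + 2)) (Fin (n + 2)) ℝ := fun a b =>
  if (a = 0 ∧ b = Fin.last (n + 1)) ∨ (a = Fin.last (n + 1) ∧ b = 0) then -1
  else if a = b ∧ a ≠ 0 ∧ a ≠ Fin.last (n + 1) then 1
  else 0

/-- The Lorentzian product on `ℝ^{n+2}`. -/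
def lorentzForm (n : ℕ) : LinearMap.BilinForm ℝ (Fin (n + 2) → ℝ) :=
  Matrix.toBilin' (lorentzMatrix n)

/-- The positive light cone. -/
def lightCone (n : ℕ) : Set (Fin (n + 2) → ℝ) :=
  {v | lorentzForm n v v = 0 ∧ 0 < v 0 + v (Fin.last (n + 1))}

/-- The Möbius group: the orientation preserving orthochronous Lorentz transformations. -/
def moebiusGroup (n : ℕ) : Set (Matrix (Fin (n + 2)) (Fin (n + 2)) ℝ) :=
  {G | G.transpose * lorentzMatrix n * G = lorentzMatrix n ∧ G.det = 1 ∧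
    ∀ v ∈ lightCone n, G.mulVec v ∈ lightCone n}

/-- The conformal `n`-sphere, as the Darboux hyperquadric in real projective space. -/
def ConformalSphere (n : ℕ) : Type :=
  {p : Projectivization ℝ (Fin (n + 2) → ℝ) // ∀ v ∈ p.submodule, lorentzForm n v v = 0}

/-- The vector `(1, x, |x|²/2)` of homogeneous coordinates of the image of `x`. -/
def diracWeylVec {n : ℕ} (x : EuclideanSpace ℝ (Fin n)) : Fin (n + 2) → ℝ :=
  Fin.cons (α := fun _ => ℝ) 1 (Fin.snoc (α := fun _ => ℝ) (fun i => x i) (‖x‖ ^ 2 / 2))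

theorem diracWeylVec_ne_zero {n : ℕ} (x : EuclideanSpace ℝ (Fin n)) : diracWeylVec x ≠ 0 := by
  intro h
  have h0 := congrFun h 0
  simp [diracWeylVec] at h0

theorem lorentzForm_apply {n : ℕ} (v w : Fin (n + 2) → ℝ) :
    lorentzForm n v w = -(v 0 * w (Fin.last (n + 1))) - v (Fin.last (n + 1)) * w 0
      + ∑ i : Fin n, v i.castSucc.succ * w i.castSucc.succ := by
  have h1 : ∀ i : Fin n, i.castSucc.succ ≠ Fin.last (n + 1) := by
    intro i
    rw [Fin.succ_castSucc]
    exact (Fin.castSucc_lt_last _).ne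
  have h2 : (0 : Fin (n + 2)) ≠ Fin.last (n + 1) := (Fin.last_pos).ne
  have h3 : ∀ i : Fin n, Fin.last (n + 1) ≠ i.castSucc.succ := fun i => (h1 i).symm
  have h4 : (0 : Fin (n + 2)) ≠ (Fin.last n).succ := h2
  rw [lorentzForm, Matrix.toBilin'_apply]
  rw [Fin.sum_univ_succ, Fin.sum_univ_castSucc]
  simp only [Fin.sum_univ_succ (n := n + 1), Fin.sum_univ_castSucc (n := n), Fin.succ_last]
  simp [lorentzMatrix, h1, h2, h2.symm, h3, Fin.succ_ne_zero, Finset.sum_ite_eq]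
  ring

theorem lorentzForm_diracWeylVec {n : ℕ} (x : EuclideanSpace ℝ (Fin n)) :
    lorentzForm n (diracWeylVec x) (diracWeylVec x) = 0 := by
  have h : diracWeylVec x (Fin.last (n + 1)) = ‖x‖ ^ 2 / 2 := by
    rw [← Fin.succ_last]
    simp [diracWeylVec]
  rw [lorentzForm_apply, h, EuclideanSpace.real_norm_sq_eq]
  simp [diracWeylVec, pow_two]
  ring

/-- The Dirac-Weyl embedding `ℝⁿ → Q_n`. -/
def diracWeyl {n : ℕ} (x : EuclideanSpace ℝ (Fin n)) : ConformalSphere n :=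
  ⟨Projectivization.mk ℝ (diracWeylVec x) (diracWeylVec_ne_zero x), by
    intro v hv
    rw [Projectivization.submodule_mk, Submodule.mem_span_singleton] at hv
    obtain ⟨a, rfl⟩ := hv
    simp [lorentzForm_diracWeylVec]⟩

/-- `η` is a smooth family of homogeneous coordinates of the curve `f` over `I`. -/
def IsSmoothLift {n : ℕ} (I : Set ℝ) (f : ℝ → ConformalSphere n)
    (η : ℝ → Fin (n + 2) → ℝ) : Prop :=
  ContDiffOn ℝ ∞ η I ∧ ∀ t ∈ I, (f t).1.submodule = Submodule.span ℝ {η t}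

/-- The coefficient `φ^a_b (d/dt)` of the pulled back Maurer-Cartan form `φ = e⁻¹ de`. -/
def frameForm {n : ℕ} (e : ℝ → Matrix (Fin (n + 2)) (Fin (n + 2)) ℝ) (a b : ℕ) (t : ℝ) : ℝ :=
  ((e t)⁻¹ * Matrix.of fun c d => deriv (fun u => e u c d) t)
    (Fin.ofNat (n + 2) a) (Fin.ofNat (n + 2) b)

/-- `e` is a conformal Frenet frame over `I` along the curve `f` in `Q_n` (`n ≥ 3`). Such a frame
exists exactly when `f` is an `(n-2)`-generic immersion. -/
structure IsConformalFrenetFrame {n : ℕ} (I : Set ℝ) (f : ℝ → ConformalSphere n)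
    (e : ℝ → Matrix (Fin (n + 2)) (Fin (n + 2)) ℝ) : Prop where
  mem_moebius : ∀ t ∈ I, e t ∈ moebiusGroup n
  smooth : ∀ a b, ContDiffOn ℝ ∞ (fun t => e t a b) I
  along : ∀ t ∈ I, (f t).1.submodule = Submodule.span ℝ {fun a => e t a 0}
  immersed : ∀ t ∈ I, 0 < frameForm e 1 0 t
  first_order : ∀ t ∈ I, ∀ a, 2 ≤ a → a ≤ n → frameForm e a 0 t = 0
  second_order : ∀ t ∈ I, ∀ a, 2 ≤ a → a ≤ n → frameForm e a 1 t = 0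
  third_order : ∀ t ∈ I, frameForm e 0 2 t = frameForm e 1 0 t
  third_order' : ∀ t ∈ I, ∀ b, 3 ≤ b → b ≤ n → frameForm e 0 b t = 0
  special : ∀ t ∈ I, frameForm e 0 0 t = 0
  higher_order : ∀ t ∈ I, ∀ k b, 2 ≤ k → k + 2 ≤ b → b ≤ n → frameForm e b k t = 0
  generic : ∀ t ∈ I, ∀ k, 2 ≤ k → k + 2 ≤ n → 0 < frameForm e (k + 1) k t

/-- `s` is a conformal arclength, `ds = φ¹₀`, where `e` is a frame of order at least three. -/
def IsConformalArclength {n : ℕ} (I : Set ℝ)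
    (e : ℝ → Matrix (Fin (n + 2)) (Fin (n + 2)) ℝ) (s : ℝ → ℝ) : Prop :=
  ∀ t ∈ I, HasDerivAt s (frameForm e 1 0 t) t

/-- The conformal curvature `μ_j`, `2 ≤ j ≤ n - 1`, given by `φ^{j+1}_j = μ_j φ¹₀` in a conformal
Frenet frame. -/
def conformalCurvature {n : ℕ} (e : ℝ → Matrix (Fin (n + 2)) (Fin (n + 2)) ℝ)
    (j : ℕ) (t : ℝ) : ℝ :=
  frameForm e (j + 1) j t / frameForm e 1 0 t

/-- The space `V_j(t)` spanned by the derivatives of orders `0, …, j + 1` of a lift `η`. -/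
def osculatingSpace {n : ℕ} (η : ℝ → Fin (n + 2) → ℝ) (j : ℕ) (t : ℝ) :
    Submodule ℝ (Fin (n + 2) → ℝ) :=
  Submodule.span ℝ {v | ∃ i ≤ j + 1, v = iteratedDeriv i η t}

open Classical in
/-- The Lorentz-orthogonal projection onto a nondegenerate subspace `V`. -/
def lorentzProj {n : ℕ} (V : Submodule ℝ (Fin (n + 2) → ℝ)) :
    (Fin (n + 2) → ℝ) →ₗ[ℝ] (Fin (n + 2) → ℝ) :=
  if h : IsCompl V ((lorentzForm n).orthogonal V) then
    V.projection ((lorentzForm n).orthogonal V) h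
  else 0

theorem lorentzProj_mem {n : ℕ} (V : Submodule ℝ (Fin (n + 2) → ℝ)) (x : Fin (n + 2) → ℝ) :
    lorentzProj V x ∈ V := by
  unfold lorentzProj
  split_ifs with h
  · simp
  · simp

/-- The trace of `π ∘ π'` on `π(V')`, where `π`, `π'` are the Lorentz-orthogonal projections onto
`V`, `V'`: the invariant `T_j` of the pair of `j`-spheres given by `V` and `V'`. -/
def traceInvariant {n : ℕ} (V V' : Submodule ℝ (Fin (n + 2) → ℝ)) : ℝ :=
  LinearMap.trace ℝ (V'.map (lorentzProj V))
    ((lorentzProj V ∘ₗ lorentzProj V').restrict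
      (fun x _ => Submodule.mem_map_of_mem (lorentzProj_mem V' x)))

/-- `h ↦ T_j(V_j(s + h), V_j(s))` at the point with parameter `t`, where the curve is
reparametrized by the conformal arclength `s` on `I`. -/
def osculatingTrace {n : ℕ} (I : Set ℝ) (η : ℝ → Fin (n + 2) → ℝ) (s : ℝ → ℝ)
    (j : ℕ) (t h : ℝ) : ℝ :=
  traceInvariant (osculatingSpace η j (Function.invFunOn s I (s t + h))) (osculatingSpace η j t)

/-- The invariant `k_j = √(-½ ∂²T_j/∂h² |_{h=0})`. -/
def traceCurvature {n : ℕ} (I : Set ℝ) (η : ℝ → Fin (n + 2) → ℝ) (s : ℝ → ℝ)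
    (j : ℕ) (t : ℝ) : ℝ :=
  Real.sqrt (-(1 / 2) * iteratedDeriv 2 (osculatingTrace I η s j t) 0)

/-- `(E_1, …, E_n)` is the Euclidean Frenet frame over `I` of the immersed curve `F` in `ℝⁿ`
(`n ≥ 3`), with curvature `k` and higher curvatures `τ_2, …, τ_{n-1}`, none of which vanishes. -/
structure IsEuclideanFrenetFrame {n : ℕ} (I : Set ℝ) (F : ℝ → EuclideanSpace ℝ (Fin n))
    (E : ℕ → ℝ → EuclideanSpace ℝ (Fin n)) (k : ℝ → ℝ) (τ : ℕ → ℝ → ℝ) : Prop where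
  smooth_curve : ContDiffOn ℝ ∞ F I
  immersed : ∀ t ∈ I, deriv F t ≠ 0
  smooth_frame : ∀ a, 1 ≤ a → a ≤ n → ContDiffOn ℝ ∞ (E a) I
  orthonormal : ∀ t ∈ I, ∀ a b, 1 ≤ a → a ≤ n → 1 ≤ b → b ≤ n →
    inner ℝ (E a t) (E b t) = if a = b then 1 else 0
  oriented : ∀ t ∈ I, (Matrix.of fun a b : Fin n => E (b + 1) t a).det = 1
  deriv_curve : ∀ t ∈ I, deriv F t = ‖deriv F t‖ • E 1 t
  deriv_one : ∀ t ∈ I, deriv (E 1) t = ‖deriv F t‖ • k t • E 2 t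
  deriv_two : ∀ t ∈ I, deriv (E 2) t = ‖deriv F t‖ • (-k t • E 1 t + τ 2 t • E 3 t)
  deriv_mid : ∀ t ∈ I, ∀ a, 3 ≤ a → a + 1 ≤ n →
    deriv (E a) t = ‖deriv F t‖ • (-τ (a - 1) t • E (a - 1) t + τ a t • E (a + 1) t)
  deriv_last : ∀ t ∈ I, deriv (E n) t = ‖deriv F t‖ • (-τ (n - 1) t • E (n - 1) t)
  curvature_pos : ∀ t ∈ I, 0 < k t
  torsion_pos : ∀ t ∈ I, ∀ a, 2 ≤ a → a + 2 ≤ n → 0 < τ a t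
  torsion_last : ∀ t ∈ I, τ (n - 1) t ≠ 0

/-- The osculating `i`-sphere of `F` at `t`, as a subset of `ℝⁿ`. -/
def osculatingSphere {n : ℕ} (F : ℝ → EuclideanSpace ℝ (Fin n)) (i : ℕ) (t : ℝ) :
    Set (EuclideanSpace ℝ (Fin n)) :=
  {x | diracWeylVec x ∈ osculatingSpace (fun u => diracWeylVec (F u)) i t}

/-- `S` is the round `i`-sphere with centre `c` and radius `r` in some `(i+1)`-dimensional affine
subspace. For `i ≥ 1` the set `S` determines `c` and `r`. -/
def IsRoundSphere {n : ℕ} (i : ℕ) (S : Set (EuclideanSpace ℝ (Fin n)))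
    (c : EuclideanSpace ℝ (Fin n)) (r : ℝ) : Prop :=
  0 < r ∧ ∃ A : AffineSubspace ℝ (EuclideanSpace ℝ (Fin n)),
    Module.finrank ℝ A.direction = i + 1 ∧ c ∈ A ∧ S = {x | x ∈ A ∧ dist x c = r}

/-- `[(k')² + k² τ_2²]^{1/4}`, where `'` is the derivative in the Euclidean arclength of `F`. -/
def arclengthRatio {n : ℕ} (F : ℝ → EuclideanSpace ℝ (Fin n)) (k : ℝ → ℝ) (τ : ℕ → ℝ → ℝ)
    (t : ℝ) : ℝ :=
  ((deriv k t / ‖deriv F t‖) ^ 2 + k t ^ 2 * τ 2 t ^ 2) ^ (1 / 4 : ℝ)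

end

/-! Everything is read off from orthogonal complements. In the flag e_0, e_1, e_{n+1}, e_2, e_3, …
differentiation raises the step by one with a nonvanishing leading coefficient. Hence the
derivatives of orders 0, …, j+1 of any lift span the first j+2 members, and V_j is the orthogonal
complement of the spacelike vectors e_{j+1}, …, e_n (`mem_osculatingSpace_iff`). The curvature
μ_{n-1} would enter only in the step to e_n, which is never needed.

For (a), the projections are id - Σ ⟨·, e_a⟩ e_a, so T_j is a constant plus Σ ⟨e_a(u), e_b(t)⟩² over
a, b > j (`traceInvariant_eq`). With m_j = μ_j ds/dt, the Frenet equations make its u-derivative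
telescope to -2 m_j Σ_b ⟨e_j(u), e_b(t)⟩⟨e_{j+1}(u), e_b(t)⟩. This sum vanishes at u = t and has
derivative m_j there, so the second derivative in the conformal arclength is -2 μ_j²
(`osculatingTrace_deriv`).

For (b), lift the Euclidean frame to D, h_1, …, h_n with a constant null vector N, and put Y_i = D +
Σ p_a h_a, 2 ≤ a ≤ i+1. The recursion for p_a is such that Y_i' involves only h_{i+1} and h_{i+2}
(`hasDerivAt_sphereVec`). Hence Y_i, h_{i+2}, …, h_n cut out V_i (`orthogonal_frame_iff`), and the
points of V_i form a round sphere with squared radius R_i = Σ p_a². One Gram-Schmidt step shows that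
e_a is proportional to B_a = p_{a+1} Y_{a-1} - R_{a-1} h_{a+1}, or to B_n = Y_{n-1} if a = n
(`normalVec_eq_smul`). Pairing B_j with B_{j+1}' gives m_j² (`sq_mul_normalSq`); only squares appear
because the signs of the factors are unknown, and positivity or an absolute value settles the root.

It remains to find w = ds/dt. From e_0 = c D one gets w² = c² v², with v the Euclidean speed, and
differentiating ⟨κ_1 h_2 + N, e_2⟩ = 0 gives the product w c (`speed_pow_four`). -/

/-! ### Calculus with the Lorentzian product. -/

section LorentzCalculus

variable {n : ℕ}

theorem lorentzForm_eq_dotProduct (v w : Fin (n + 2) → ℝ) :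
    lorentzForm n v w = v ⬝ᵥ (lorentzMatrix n).mulVec w := by
  rw [lorentzForm, Matrix.toBilin'_apply']

theorem lorentzForm_comm (v w : Fin (n + 2) → ℝ) : lorentzForm n v w = lorentzForm n w v := by
  simp only [lorentzForm_apply]
  rw [Finset.sum_congr rfl fun i _ => mul_comm (v _) (w _)]
  ring

theorem HasDerivAt.lorentzForm {X Y : ℝ → Fin (n + 2) → ℝ} {X' Y' : Fin (n + 2) → ℝ} {t : ℝ}
    (hX : HasDerivAt X X' t) (hY : HasDerivAt Y Y' t) :
    HasDerivAt (fun u => lorentzForm n (X u) (Y u))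
      (lorentzForm n X' (Y t) + lorentzForm n (X t) Y') t := by
  rw [hasDerivAt_pi] at hX hY
  simp only [lorentzForm_apply]
  have hs := HasDerivAt.fun_sum (u := Finset.univ) fun (i : Fin n) _ =>
    (hX i.castSucc.succ).fun_mul (hY i.castSucc.succ)
  refine ((((hX 0).fun_mul (hY (Fin.last _))).fun_neg.fun_sub
    ((hX (Fin.last _)).fun_mul (hY 0))).fun_add hs).congr_deriv ?_
  rw [Finset.sum_add_distrib]
  ring

theorem ContDiffOn.lorentzForm {I : Set ℝ} {X Y : ℝ → Fin (n + 2) → ℝ}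
    (hX : ContDiffOn ℝ ∞ X I) (hY : ContDiffOn ℝ ∞ Y I) :
    ContDiffOn ℝ ∞ (fun u => lorentzForm n (X u) (Y u)) I := by
  rw [contDiffOn_pi] at hX hY
  simp only [lorentzForm_apply]
  exact ((((hX 0).mul (hY _)).neg).sub ((hX _).mul (hY 0))).add
    (ContDiffOn.sum fun i _ => (hX _).mul (hY _))

/-- Two smooth functions that are orthogonal along an open set have opposite mixed products. -/
theorem lorentzForm_deriv_eq_neg {I : Set ℝ} (hI : IsOpen I) {X Y : ℝ → Fin (n + 2) → ℝ}
    {X' Y' : Fin (n + 2) → ℝ} {t : ℝ} (ht : t ∈ I) {c : ℝ}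
    (h : ∀ u ∈ I, lorentzForm n (X u) (Y u) = c)
    (hX : HasDerivAt X X' t) (hY : HasDerivAt Y Y' t) :
    lorentzForm n X' (Y t) = -lorentzForm n (X t) Y' := by
  have h1 := hX.lorentzForm hY
  have h2 : HasDerivAt (fun u => lorentzForm n (X u) (Y u)) 0 t :=
    (hasDerivAt_const t c).congr_of_eventuallyEq
      (Filter.eventually_of_mem (hI.mem_nhds ht) h)
  linarith [h1.unique h2]

theorem lorentzForm_sum_smul_left {ι : Type*} (S : Finset ι) (c : ι → ℝ)
    (X : ι → Fin (n + 2) → ℝ) (Y : Fin (n + 2) → ℝ) :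
    lorentzForm n (∑ i ∈ S, c i • X i) Y = ∑ i ∈ S, c i * lorentzForm n (X i) Y := by
  simp [map_sum, LinearMap.sum_apply]

/-- The matrix is a signed permutation exchanging 0 and n+1, so each row has a single nonzero entry.
-/
theorem lorentzMatrix_mul_self (n : ℕ) : lorentzMatrix n * lorentzMatrix n = 1 := by
  have h2 : (0 : Fin (n + 2)) ≠ Fin.last (n + 1) := (Fin.last_pos).ne
  ext a b
  rw [Matrix.mul_apply, Matrix.one_apply]
  have key : ∀ c, lorentzMatrix n a c * lorentzMatrix n c b =
      if c = (if a = 0 then Fin.last (n + 1) else if a = Fin.last (n + 1) then 0 else a) then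
        (if a = b then 1 else 0) else 0 := by
    intro c
    simp only [lorentzMatrix]
    grind
  rw [Finset.sum_congr rfl fun c _ => key c]
  simp

end LorentzCalculus

/-! ### Conformal Frenet frames and their structure equations. -/

/-- A family `e_0, …, e_{n+1}` of curves of Lorentz frames over `I` that solves the conformal
Frenet equations, in an arbitrary parameter, with `w = ds/dt` and `m_k = w μ_k`. -/
structure ConformalFrenetSystem {n : ℕ} (I : Set ℝ) (e : ℕ → ℝ → Fin (n + 2) → ℝ)
    (w ψ : ℝ → ℝ) (m : ℕ → ℝ → ℝ) : Prop where
  smooth : ∀ a, ContDiffOn ℝ ∞ (e a) I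
  smooth_w : ContDiffOn ℝ ∞ w I
  smooth_ψ : ContDiffOn ℝ ∞ ψ I
  smooth_m : ∀ k, k ≤ n → ContDiffOn ℝ ∞ (m k) I
  zero_zero : ∀ t ∈ I, lorentzForm n (e 0 t) (e 0 t) = 0
  zero_last : ∀ t ∈ I, lorentzForm n (e 0 t) (e (n + 1) t) = -1
  last_last : ∀ t ∈ I, lorentzForm n (e (n + 1) t) (e (n + 1) t) = 0
  zero_mid : ∀ t ∈ I, ∀ a, 1 ≤ a → a ≤ n → lorentzForm n (e 0 t) (e a t) = 0
  last_mid : ∀ t ∈ I, ∀ a, 1 ≤ a → a ≤ n → lorentzForm n (e (n + 1) t) (e a t) = 0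
  mid_mid : ∀ t ∈ I, ∀ a b, 1 ≤ a → a ≤ n → 1 ≤ b → b ≤ n →
    lorentzForm n (e a t) (e b t) = if a = b then 1 else 0
  expand : ∀ t ∈ I, ∀ X, X = -lorentzForm n X (e (n + 1) t) • e 0 t
    - lorentzForm n X (e 0 t) • e (n + 1) t
    + ∑ a ∈ Finset.Icc 1 n, lorentzForm n X (e a t) • e a t
  deriv_zero : ∀ t ∈ I, HasDerivAt (e 0) (w t • e 1 t) t
  deriv_one : ∀ t ∈ I, HasDerivAt (e 1) (ψ t • e 0 t + w t • e (n + 1) t) t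
  deriv_last : ∀ t ∈ I, HasDerivAt (e (n + 1)) (ψ t • e 1 t + w t • e 2 t) t
  deriv_two : ∀ t ∈ I, HasDerivAt (e 2) (w t • e 0 t + m 2 t • e 3 t) t
  deriv_mid : ∀ t ∈ I, ∀ k, 3 ≤ k → k ≤ n →
    HasDerivAt (e k) (-m (k - 1) t • e (k - 1) t + m k t • e (k + 1) t) t
  w_pos : ∀ t ∈ I, 0 < w t
  m_pos : ∀ t ∈ I, ∀ k, 2 ≤ k → k + 2 ≤ n → 0 < m k t
  m_top : ∀ t ∈ I, m n t = 0

section FrameVectors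

variable {n : ℕ}

/-- The vector `e_a` of a curve of frames. -/
def frameVec (e : ℝ → Matrix (Fin (n + 2)) (Fin (n + 2)) ℝ) (a : ℕ) (t : ℝ) : Fin (n + 2) → ℝ :=
  fun c => e t c (Fin.ofNat (n + 2) a)

theorem fin_ofNat_val {n a : ℕ} (ha : a ≤ n + 1) : (Fin.ofNat (n + 2) a).val = a := by
  simp [Fin.ofNat]; omega

theorem lorentzMatrix_ofNat {a b : ℕ} (ha : a ≤ n + 1) (hb : b ≤ n + 1) :
    lorentzMatrix n (Fin.ofNat (n + 2) a) (Fin.ofNat (n + 2) b) =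
      if (a = 0 ∧ b = n + 1) ∨ (a = n + 1 ∧ b = 0) then -1
      else if a = b ∧ a ≠ 0 ∧ a ≠ n + 1 then 1 else 0 := by
  simp only [lorentzMatrix, Fin.ext_iff, fin_ofNat_val ha, fin_ofNat_val hb, Fin.val_last, ne_eq,
    Fin.val_zero]

theorem lorentzForm_frameVec {e : ℝ → Matrix (Fin (n + 2)) (Fin (n + 2)) ℝ} {t : ℝ}
    (he : (e t).transpose * lorentzMatrix n * e t = lorentzMatrix n) (a b : ℕ) :
    lorentzForm n (frameVec e a t) (frameVec e b t) =
      lorentzMatrix n (Fin.ofNat (n + 2) a) (Fin.ofNat (n + 2) b) := by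
  conv_rhs => rw [← he]
  rw [lorentzForm_eq_dotProduct, Matrix.mul_assoc, Matrix.mul_apply]
  rfl

theorem inv_eq_of_lorentz {G : Matrix (Fin (n + 2)) (Fin (n + 2)) ℝ}
    (h : G.transpose * lorentzMatrix n * G = lorentzMatrix n) :
    G⁻¹ = lorentzMatrix n * G.transpose * lorentzMatrix n := by
  apply Matrix.inv_eq_left_inv
  rw [Matrix.mul_assoc, Matrix.mul_assoc, ← Matrix.mul_assoc G.transpose, h, lorentzMatrix_mul_self]

theorem mul_inv_of_lorentz {G : Matrix (Fin (n + 2)) (Fin (n + 2)) ℝ}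
    (h : G.transpose * lorentzMatrix n * G = lorentzMatrix n) :
    G * (lorentzMatrix n * G.transpose * lorentzMatrix n) = 1 := by
  rw [mul_eq_one_comm]
  rw [Matrix.mul_assoc, Matrix.mul_assoc, ← Matrix.mul_assoc G.transpose, h, lorentzMatrix_mul_self]

theorem sum_lorentzMatrix_mul {a : ℕ} (ha : a ≤ n + 1) (x : Fin (n + 2) → ℝ) :
    ∑ c, lorentzMatrix n (Fin.ofNat (n + 2) a) c * x c =
      if a = 0 then -x (Fin.ofNat (n + 2) (n + 1))
      else if a = n + 1 then -x (Fin.ofNat (n + 2) 0) else x (Fin.ofNat (n + 2) a) := by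
  have key : ∀ c, lorentzMatrix n (Fin.ofNat (n + 2) a) c * x c =
      if c = (if a = 0 then Fin.ofNat (n + 2) (n + 1) else if a = n + 1 then Fin.ofNat (n + 2) 0
        else Fin.ofNat (n + 2) a) then
        (if a = 0 then -x (Fin.ofNat (n + 2) (n + 1))
      else if a = n + 1 then -x (Fin.ofNat (n + 2) 0) else x (Fin.ofNat (n + 2) a)) else 0 := by
    intro c
    obtain ⟨b, hb, rfl⟩ : ∃ b, b ≤ n + 1 ∧ c = Fin.ofNat (n + 2) b :=
      ⟨c.val, by omega, by ext; rw [fin_ofNat_val (by omega)]⟩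
    rw [lorentzMatrix_ofNat ha hb]
    have hinj : ∀ b', b' ≤ n + 1 → (Fin.ofNat (n + 2) b = Fin.ofNat (n + 2) b' ↔ b = b') := by
      intro b' hb'
      rw [Fin.ext_iff, fin_ofNat_val hb, fin_ofNat_val hb']
    split_ifs <;> grind
  rw [Finset.sum_congr rfl fun c _ => key c, Finset.sum_ite_eq']
  simp

/-- With J the Gram matrix, e⁻¹ = J eᵀ J. So a coefficient is the pairing with the dual basis
vector, which is -e_{n+1} for e_0, -e_0 for e_{n+1}, and e_a itself for the others. -/
theorem frameForm_eq {e : ℝ → Matrix (Fin (n + 2)) (Fin (n + 2)) ℝ} {t : ℝ}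
    (he : (e t).transpose * lorentzMatrix n * e t = lorentzMatrix n) {a : ℕ} (ha : a ≤ n + 1)
    (b : ℕ) {v : Fin (n + 2) → ℝ} (hv : HasDerivAt (frameVec e b) v t) :
    frameForm e a b t =
      if a = 0 then -lorentzForm n (frameVec e (n + 1) t) v
      else if a = n + 1 then -lorentzForm n (frameVec e 0 t) v
      else lorentzForm n (frameVec e a t) v := by
  have hv' : ∀ c, deriv (fun u => e u c (Fin.ofNat (n + 2) b)) t = v c := fun c =>
    ((hasDerivAt_pi.1 hv) c).deriv
  have h := sum_lorentzMatrix_mul ha (fun c => lorentzForm n (frameVec e c t) v)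
  simp only [fin_ofNat_val ha, fin_ofNat_val le_rfl, fin_ofNat_val (Nat.zero_le _)] at h
  rw [← h, frameForm, inv_eq_of_lorentz he, Matrix.mul_assoc, Matrix.mul_assoc, Matrix.mul_apply]
  refine Finset.sum_congr rfl fun c _ => ?_
  congr 1
  rw [lorentzForm_eq_dotProduct, Matrix.mul_apply]
  simp only [Matrix.mul_apply, dotProduct, Matrix.mulVec, Matrix.transpose_apply, Matrix.of_apply,
    hv', frameVec]
  simp

theorem sum_univ_fin_add_two {M : Type*} [AddCommMonoid M] (x : ℕ → M) :
    ∑ c : Fin (n + 2), x c.val = x 0 + ∑ a ∈ Finset.Icc 1 n, x a + x (n + 1) := by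
  rw [Fin.sum_univ_eq_sum_range, Finset.sum_range_succ, Finset.sum_range_succ']
  rw [Finset.range_eq_Ico, Finset.sum_Ico_add' x 0 n 1, add_comm _ (x 0)]
  rfl

theorem frameVec_expand {e : ℝ → Matrix (Fin (n + 2)) (Fin (n + 2)) ℝ} {t : ℝ}
    (he : (e t).transpose * lorentzMatrix n * e t = lorentzMatrix n) (X : Fin (n + 2) → ℝ) :
    X = -lorentzForm n X (frameVec e (n + 1) t) • frameVec e 0 t
    - lorentzForm n X (frameVec e 0 t) • frameVec e (n + 1) t
    + ∑ a ∈ Finset.Icc 1 n, lorentzForm n X (frameVec e a t) • frameVec e a t := by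
  have h1 : X = (e t * (lorentzMatrix n * (e t).transpose * lorentzMatrix n)).mulVec X := by
    rw [mul_inv_of_lorentz he, Matrix.one_mulVec]
  have h2 : ∀ c : Fin (n + 2), ((lorentzMatrix n * (e t).transpose * lorentzMatrix n).mulVec X) c =
      if c.val = 0 then -lorentzForm n X (frameVec e (n + 1) t)
      else if c.val = n + 1 then -lorentzForm n X (frameVec e 0 t)
      else lorentzForm n X (frameVec e c t) := by
    intro c
    have hc : c.val ≤ n + 1 := by omega
    have h3 := sum_lorentzMatrix_mul hc (fun c => lorentzForm n (frameVec e c t) X)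
    simp only [fin_ofNat_val hc, fin_ofNat_val le_rfl, fin_ofNat_val (Nat.zero_le _)] at h3
    simp only [lorentzForm_comm X]
    rw [← h3, Matrix.mul_assoc, ← Matrix.mulVec_mulVec, Matrix.mulVec, dotProduct]
    simp only [Fin.ofNat_eq_cast, Fin.cast_val_eq_self]
    refine Finset.sum_congr rfl fun d _ => ?_
    congr 1
    rw [lorentzForm_eq_dotProduct, ← Matrix.mulVec_mulVec, Matrix.mulVec]
    simp only [dotProduct, Matrix.transpose_apply, frameVec]
    simp
  rw [← Matrix.mulVec_mulVec] at h1
  conv_lhs => rw [h1]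
  have h4 : (e t).mulVec ((lorentzMatrix n * (e t).transpose * lorentzMatrix n).mulVec X) =
      ∑ c : Fin (n + 2), ((lorentzMatrix n * (e t).transpose * lorentzMatrix n).mulVec X) c •
        frameVec e c t := by
    ext d
    simp [Matrix.mulVec, dotProduct, frameVec, mul_comm]
  rw [h4]
  simp only [h2]
  rw [sum_univ_fin_add_two (fun c => (if c = 0 then -lorentzForm n X (frameVec e (n + 1) t)
      else if c = n + 1 then -lorentzForm n X (frameVec e 0 t)
      else lorentzForm n X (frameVec e c t)) • frameVec e c t)]
  rw [Finset.sum_congr rfl (g := fun a => lorentzForm n X (frameVec e a t) • frameVec e a t)]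
  · simp only [if_true, Nat.succ_ne_zero, if_false, neg_smul]
    abel
  · intro a ha
    rw [Finset.mem_Icc] at ha
    rw [if_neg (by omega), if_neg (by omega)]

end FrameVectors

section FrameSystem

variable {n : ℕ} {I : Set ℝ} {f : ℝ → ConformalSphere n}
  {e : ℝ → Matrix (Fin (n + 2)) (Fin (n + 2)) ℝ}

theorem IsConformalFrenetFrame.lorentz (he : IsConformalFrenetFrame I f e) {t : ℝ} (ht : t ∈ I) :
    (e t).transpose * lorentzMatrix n * e t = lorentzMatrix n :=
  (he.mem_moebius t ht).1

theorem IsConformalFrenetFrame.contDiffOn_frameVec (he : IsConformalFrenetFrame I f e) (a : ℕ) :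
    ContDiffOn ℝ ∞ (frameVec e a) I :=
  contDiffOn_pi.2 fun c => he.smooth c _

theorem IsConformalFrenetFrame.hasDerivAt_frameVec (he : IsConformalFrenetFrame I f e)
    (hI : IsOpen I) (a : ℕ) {t : ℝ} (ht : t ∈ I) :
    HasDerivAt (frameVec e a) (deriv (frameVec e a) t) t :=
  (((he.contDiffOn_frameVec a).differentiableOn (by simp)).differentiableAt
    (hI.mem_nhds ht)).hasDerivAt

theorem IsConformalFrenetFrame.contDiffOn_frameForm (he : IsConformalFrenetFrame I f e)
    (hI : IsOpen I) {a : ℕ} (ha : a ≤ n + 1) (b : ℕ) :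
    ContDiffOn ℝ ∞ (frameForm e a b) I := by
  have h : ∀ c, ContDiffOn ℝ ∞
      (fun t => lorentzForm n (frameVec e c t) (deriv (frameVec e b) t)) I := fun c =>
    (he.contDiffOn_frameVec c).lorentzForm
      ((contDiffOn_infty_iff_deriv_of_isOpen hI).1 (he.contDiffOn_frameVec b)).2
  have h2 := fun t (ht : t ∈ I) =>
    frameForm_eq (he.lorentz ht) ha b (he.hasDerivAt_frameVec hI b ht)
  refine ContDiffOn.congr (f := fun t => _) ?_ h2
  split_ifs
  · exact (h _).neg
  · exact (h _).neg
  · exact h _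

theorem IsConformalFrenetFrame.frameVec_ext (he : IsConformalFrenetFrame I f e) {t : ℝ}
    (ht : t ∈ I) {X Y : Fin (n + 2) → ℝ}
    (h0 : lorentzForm n (frameVec e 0 t) X = lorentzForm n (frameVec e 0 t) Y)
    (h1 : lorentzForm n (frameVec e (n + 1) t) X = lorentzForm n (frameVec e (n + 1) t) Y)
    (h : ∀ a, 1 ≤ a → a ≤ n →
      lorentzForm n (frameVec e a t) X = lorentzForm n (frameVec e a t) Y) : X = Y := by
  rw [frameVec_expand (he.lorentz ht) X, frameVec_expand (he.lorentz ht) Y]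
  simp only [lorentzForm_comm X, lorentzForm_comm Y, h0, h1]
  congr 1
  refine Finset.sum_congr rfl fun a ha => ?_
  rw [Finset.mem_Icc] at ha
  rw [h a ha.1 ha.2]

/-- Differentiating the constant Gram matrix makes the Maurer-Cartan form skew for the Lorentzian
product. The vanishing conditions on part of its entries then determine the whole form. -/
theorem IsConformalFrenetFrame.system (hn : 3 ≤ n) (hI : IsOpen I)
    (he : IsConformalFrenetFrame I f e) :
    ConformalFrenetSystem I (frameVec e) (frameForm e 1 0) (frameForm e 0 1)
      (fun k => frameForm e (k + 1) k) := by
  have gram : ∀ t ∈ I, ∀ a b, a ≤ n + 1 → b ≤ n + 1 →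
      lorentzForm n (frameVec e a t) (frameVec e b t) =
      if (a = 0 ∧ b = n + 1) ∨ (a = n + 1 ∧ b = 0) then -1
      else if a = b ∧ a ≠ 0 ∧ a ≠ n + 1 then 1 else 0 := fun t ht a b ha hb => by
    rw [lorentzForm_frameVec (he.lorentz ht), lorentzMatrix_ofNat ha hb]
  have D := fun a t (ht : t ∈ I) => he.hasDerivAt_frameVec hI a ht
  have skew : ∀ t ∈ I, ∀ a b, lorentzForm n (frameVec e a t) (deriv (frameVec e b) t) =
      -lorentzForm n (frameVec e b t) (deriv (frameVec e a) t) := by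
    intro t ht a b
    have h := lorentzForm_deriv_eq_neg hI ht
      (fun u hu => lorentzForm_frameVec (he.lorentz hu) b a) (D b t ht) (D a t ht)
    rw [lorentzForm_comm, h]
  have q0 : ∀ t ∈ I, ∀ b, lorentzForm n (frameVec e 0 t) (deriv (frameVec e b) t) =
      -frameForm e (n + 1) b t := by
    intro t ht b
    rw [frameForm_eq (he.lorentz ht) le_rfl b (D b t ht)]; simp
  have q1 : ∀ t ∈ I, ∀ b, lorentzForm n (frameVec e (n + 1) t) (deriv (frameVec e b) t) =
      -frameForm e 0 b t := by
    intro t ht b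
    rw [frameForm_eq (he.lorentz ht) (Nat.zero_le _) b (D b t ht)]; simp
  have qm : ∀ t ∈ I, ∀ a b, 1 ≤ a → a ≤ n →
      lorentzForm n (frameVec e a t) (deriv (frameVec e b) t) = frameForm e a b t := by
    intro t ht a b h1 h2
    rw [frameForm_eq (he.lorentz ht) (by omega) b (D b t ht), if_neg (by omega), if_neg (by omega)]
  have skewm : ∀ t ∈ I, ∀ a b, 1 ≤ a → a ≤ n → 1 ≤ b → b ≤ n →
      frameForm e a b t = -frameForm e b a t := by
    intro t ht a b h1 h2 h3 h4
    rw [← qm t ht a b h1 h2, ← qm t ht b a h3 h4, skew t ht]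
  have skew0 : ∀ t ∈ I, ∀ b, 1 ≤ b → b ≤ n → frameForm e (n + 1) b t = frameForm e b 0 t := by
    intro t ht b h1 h2
    rw [← qm t ht b 0 h1 h2, skew t ht, q0 t ht, neg_neg]
  have skew1 : ∀ t ∈ I, ∀ b, 1 ≤ b → b ≤ n → frameForm e b (n + 1) t = frameForm e 0 b t := by
    intro t ht b h1 h2
    rw [← qm t ht b (n + 1) h1 h2, skew t ht, q1 t ht, neg_neg]
  have skew00 : ∀ t ∈ I, frameForm e (n + 1) 0 t = 0 := by
    intro t ht
    have := skew t ht 0 0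
    rw [q0 t ht] at this
    linarith
  have skew11 : ∀ t ∈ I, frameForm e 0 (n + 1) t = 0 := by
    intro t ht
    have := skew t ht (n + 1) (n + 1)
    rw [q1 t ht] at this
    linarith
  have skew01 : ∀ t ∈ I, frameForm e (n + 1) (n + 1) t = 0 := by
    intro t ht
    have := skew t ht 0 (n + 1)
    rw [q0 t ht, q1 t ht, he.special t ht] at this
    linarith
  -- By skewness this entry equals φ^n_0, which is zero. It lets the equation of e_n be the case k =
  -- n of the general one, although the index n+1 names a null vector.
  have top : ∀ t ∈ I, frameForm e (n + 1) n t = 0 := by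
    intro t ht
    rw [skew0 t ht n (by omega) le_rfl, he.first_order t ht n (by omega) le_rfl]
  refine
    { smooth := he.contDiffOn_frameVec
      smooth_w := he.contDiffOn_frameForm hI (by omega) 0
      smooth_ψ := he.contDiffOn_frameForm hI (by omega) 1
      smooth_m := fun k hk => he.contDiffOn_frameForm hI (by omega) k
      zero_zero := fun t ht => by rw [gram t ht _ _ (by omega) (by omega)]; simp
      zero_last := fun t ht => by rw [gram t ht _ _ (by omega) (by omega)]; simp
      last_last := fun t ht => by rw [gram t ht _ _ (by omega) (by omega)]; simp
      zero_mid := fun t ht a h1 h2 => by rw [gram t ht _ _ (by omega) (by omega)]; grind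
      last_mid := fun t ht a h1 h2 => by rw [gram t ht _ _ (by omega) (by omega)]; grind
      mid_mid := fun t ht a b h1 h2 h3 h4 => by
        rw [gram t ht _ _ (by omega) (by omega)]; grind
      expand := fun t ht X => frameVec_expand (he.lorentz ht) X
      deriv_zero := fun t ht => (D 0 t ht).congr_deriv ?_
      deriv_one := fun t ht => (D 1 t ht).congr_deriv ?_
      deriv_last := fun t ht => (D _ t ht).congr_deriv ?_
      deriv_two := fun t ht => (D 2 t ht).congr_deriv ?_
      deriv_mid := fun t ht k hk1 hk2 => (D k t ht).congr_deriv ?_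
      w_pos := he.immersed
      m_pos := he.generic
      m_top := top }
  · apply he.frameVec_ext ht
    · simp only [q0 t ht, map_smul, smul_eq_mul, skew00 t ht]
      rw [gram t ht _ _ (by omega) (by omega)]; simp; omega
    · simp only [q1 t ht, map_smul, smul_eq_mul, he.special t ht]
      rw [gram t ht _ _ (by omega) (by omega)]; simp
    · intro a h1 h2
      simp only [qm t ht a _ h1 h2, map_smul, smul_eq_mul]
      rw [gram t ht _ _ (by omega) (by omega)]
      by_cases ha : a = 1
      · subst ha; simp; omega
      · rw [he.first_order t ht a (by omega) h2]; grind
  · apply he.frameVec_ext ht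
    · simp only [q0 t ht, map_add, map_smul, smul_eq_mul, skew0 t ht 1 le_rfl (by omega)]
      rw [gram t ht _ _ (by omega) (by omega), gram t ht _ _ (by omega) (by omega)]; simp
    · simp only [q1 t ht, map_add, map_smul, smul_eq_mul]
      rw [gram t ht _ _ (by omega) (by omega), gram t ht _ _ (by omega) (by omega)]; simp
    · intro a h1 h2
      simp only [qm t ht a _ h1 h2, map_add, map_smul, smul_eq_mul]
      rw [gram t ht _ _ (by omega) (by omega), gram t ht _ _ (by omega) (by omega)]
      by_cases ha : a = 1
      · subst ha; have := skewm t ht 1 1 le_rfl (by omega) le_rfl (by omega)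
        grind
      · rw [he.second_order t ht a (by omega) h2]; grind
  · apply he.frameVec_ext ht
    · simp only [q0 t ht, map_add, map_smul, smul_eq_mul, skew01 t ht]
      rw [gram t ht _ _ (by omega) (by omega), gram t ht _ _ (by omega) (by omega)]; grind
    · simp only [q1 t ht, map_add, map_smul, smul_eq_mul, skew11 t ht]
      rw [gram t ht _ _ (by omega) (by omega), gram t ht _ _ (by omega) (by omega)]; grind
    · intro a h1 h2
      simp only [qm t ht a _ h1 h2, map_add, map_smul, smul_eq_mul, skew1 t ht a h1 h2]
      rw [gram t ht _ _ (by omega) (by omega), gram t ht _ _ (by omega) (by omega)]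
      obtain rfl | rfl | ha : a = 1 ∨ a = 2 ∨ 3 ≤ a := by omega
      · grind
      · rw [he.third_order t ht]; grind
      · rw [he.third_order' t ht a ha h2]; grind
  · apply he.frameVec_ext ht
    · simp only [q0 t ht, map_add, map_smul, smul_eq_mul, skew0 t ht 2 (by omega) (by omega)]
      rw [gram t ht _ _ (by omega) (by omega), gram t ht _ _ (by omega) (by omega),
        he.first_order t ht 2 le_rfl (by omega)]; grind
    · simp only [q1 t ht, map_add, map_smul, smul_eq_mul, he.third_order t ht]
      rw [gram t ht _ _ (by omega) (by omega), gram t ht _ _ (by omega) (by omega)]; grind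
    · intro a h1 h2
      simp only [qm t ht a _ h1 h2, map_add, map_smul, smul_eq_mul]
      rw [gram t ht _ _ (by omega) (by omega), gram t ht _ _ (by omega) (by omega)]
      obtain rfl | rfl | rfl | ha : a = 1 ∨ a = 2 ∨ a = 3 ∨ 4 ≤ a := by omega
      · rw [skewm t ht 1 2 h1 h2 (by omega) (by omega),
          he.second_order t ht 2 (by omega) (by omega)]; grind
      · have := skewm t ht 2 2 h1 h2 h1 h2
        grind
      · grind
      · rw [he.higher_order t ht 2 a le_rfl ha h2]; grind
  -- For k = n the vector e_{k+1} is null and pairs nontrivially with e_0; the vanishing coefficient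
  -- makes the formula uniform in k.
  · have hlast : ∀ c, c ≤ n → frameForm e (k + 1) k t *
        lorentzForm n (frameVec e c t) (frameVec e (k + 1) t) =
        if c = k + 1 then frameForm e (k + 1) k t else 0 := by
      intro c hc
      rw [gram t ht _ _ (by omega) (by omega)]
      by_cases hk : k = n
      · subst hk; rw [top t ht]; simp
      · grind
    apply he.frameVec_ext ht
    · simp only [q0 t ht, map_add, map_smul, smul_eq_mul, skew0 t ht k (by omega) hk2,
        hlast 0 (by omega)]
      rw [gram t ht _ _ (by omega) (by omega), he.first_order t ht k (by omega) hk2]; grind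
    · simp only [q1 t ht, map_add, map_smul, smul_eq_mul, he.third_order' t ht k hk1 hk2]
      rw [gram t ht _ _ (by omega) (by omega), gram t ht _ _ (by omega) (by omega)]; grind
    · intro a h1 h2
      simp only [qm t ht a _ h1 h2, map_add, map_smul, smul_eq_mul, hlast a h2]
      rw [gram t ht _ _ (by omega) (by omega), Nat.sub_add_cancel (by omega : 1 ≤ k)]
      obtain rfl | h | h | h | h | h : a = 1 ∨ (2 ≤ a ∧ a + 2 ≤ k) ∨ a + 1 = k ∨ a = k ∨ a = k + 1
        ∨ k + 2 ≤ a := by omega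
      · rw [skewm t ht 1 k h1 h2 (by omega) hk2, he.second_order t ht k (by omega) hk2]; grind
      · rw [skewm t ht a k h1 h2 (by omega) hk2, he.higher_order t ht a k h.1 h.2 hk2]; grind
      · rw [skewm t ht a k h1 h2 (by omega) hk2]
        subst h
        grind
      · subst h
        have := skewm t ht a a h1 h2 h1 h2
        grind
      · subst h; grind
      · rw [he.higher_order t ht k a (by omega) h h2]; grind

end FrameSystem

/-! ### Flags of curves adapted to differentiation. -/

section Flag

variable {V : Type*} [NormedAddCommGroup V] [NormedSpace ℝ V]

/-- Curves that are combinations of the curves `g_0, …, g_m` with coefficients smooth on `I`. -/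
def smoothCombinations (I : Set ℝ) (g : ℕ → ℝ → V) (m : ℕ) : Submodule ℝ (ℝ → V) :=
  Submodule.span ℝ {X | ∃ l ≤ m, ∃ c : ℝ → ℝ, ContDiffOn ℝ ∞ c I ∧ X = fun t => c t • g l t}

/-- `g_0, …, g_M` is a flag of curves over `I` in which differentiation raises the step by exactly
one. -/
def IsDerivFlag (I : Set ℝ) (g : ℕ → ℝ → V) (M : ℕ) : Prop :=
  ∀ m < M, ∃ p ≤ m, ∃ a b : ℝ → ℝ, ContDiffOn ℝ ∞ a I ∧ ContDiffOn ℝ ∞ b I ∧ (∀ t ∈ I, b t ≠ 0) ∧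
    ∀ t ∈ I, HasDerivAt (g m) (a t • g p t + b t • g (m + 1) t) t

variable {I : Set ℝ} {g : ℕ → ℝ → V} {M : ℕ}

theorem smul_mem_smoothCombinations {l m : ℕ} (hl : l ≤ m) {c : ℝ → ℝ} (hc : ContDiffOn ℝ ∞ c I) :
    (fun t => c t • g l t) ∈ smoothCombinations I g m :=
  Submodule.subset_span ⟨l, hl, c, hc, rfl⟩

theorem smoothCombinations_apply_mem {m : ℕ} {X : ℝ → V} (hX : X ∈ smoothCombinations I g m)
    (t : ℝ) : X t ∈ Submodule.span ℝ {v | ∃ l ≤ m, v = g l t} := by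
  induction hX using Submodule.span_induction with
  | mem X hX =>
    obtain ⟨l, hl, c, -, rfl⟩ := hX
    exact Submodule.smul_mem _ _ (Submodule.subset_span ⟨l, hl, rfl⟩)
  | zero => exact Submodule.zero_mem _
  | add X Y _ _ h1 h2 => exact Submodule.add_mem _ h1 h2
  | smul a X _ h => exact Submodule.smul_mem _ _ h

theorem IsDerivFlag.hasDerivAt_smul (hg : IsDerivFlag I g M) (hI : IsOpen I) {m : ℕ} (hm : m < M)
    {c : ℝ → ℝ} (hc : ContDiffOn ℝ ∞ c I) :
    ∃ Y ∈ smoothCombinations I g m, ∃ b : ℝ → ℝ, ContDiffOn ℝ ∞ b I ∧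
      (∀ t ∈ I, c t ≠ 0 → b t ≠ 0) ∧
      ∀ t ∈ I, HasDerivAt (fun t => c t • g m t) (b t • g (m + 1) t + Y t) t := by
  obtain ⟨p, hp, a, b, ha, hb, hb0, hd⟩ := hg m hm
  refine ⟨(fun t => deriv c t • g m t) + fun t => (c t * a t) • g p t,
    Submodule.add_mem _ (smul_mem_smoothCombinations le_rfl
      ((contDiffOn_infty_iff_deriv_of_isOpen hI).1 hc).2)
      (smul_mem_smoothCombinations hp (hc.mul ha)), fun t => c t * b t, hc.mul hb,
      fun t ht h => mul_ne_zero h (hb0 t ht), fun t ht => ?_⟩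
  have hc' : HasDerivAt c (deriv c t) t :=
    ((hc.differentiableOn (by simp)).differentiableAt (hI.mem_nhds ht)).hasDerivAt
  refine (hc'.fun_smul (hd t ht)).congr_deriv ?_
  simp only [Pi.add_apply]
  module

/-- The Leibniz rule on generators. It controls the lower order terms when a lift is differentiated
repeatedly. -/
theorem IsDerivFlag.hasDerivAt_smoothCombinations (hg : IsDerivFlag I g M) (hI : IsOpen I) {m : ℕ}
    (hm : m < M) {X : ℝ → V} (hX : X ∈ smoothCombinations I g m) :
    ∃ Y ∈ smoothCombinations I g (m + 1), ∀ t ∈ I, HasDerivAt X (Y t) t := by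
  have mono : ∀ l ≤ m, smoothCombinations I g l ≤ smoothCombinations I g (m + 1) := by
    intro l hl
    refine Submodule.span_mono ?_
    rintro X ⟨k, hk, h⟩
    exact ⟨k, by omega, h⟩
  induction hX using Submodule.span_induction with
  | mem X hX =>
    obtain ⟨l, hl, c, hc, rfl⟩ := hX
    obtain ⟨Y, hY, b, hb, -, h⟩ := hg.hasDerivAt_smul hI (lt_of_le_of_lt hl hm) hc
    exact ⟨_, Submodule.add_mem _ (smul_mem_smoothCombinations (by omega) hb) (mono l hl hY), h⟩
  | zero => exact ⟨0, Submodule.zero_mem _, fun t _ => hasDerivAt_const t 0⟩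
  | add X Y _ _ h1 h2 =>
    obtain ⟨X', hX', h1⟩ := h1
    obtain ⟨Y', hY', h2⟩ := h2
    exact ⟨X' + Y', Submodule.add_mem _ hX' hY', fun t ht => (h1 t ht).add (h2 t ht)⟩
  | smul a X _ h =>
    obtain ⟨X', hX', h⟩ := h
    exact ⟨a • X', Submodule.smul_mem _ _ hX', fun t ht => (h t ht).const_smul a⟩

/-- Each differentiation multiplies the leading coefficient by a nonvanishing coefficient of the
flag, while the remainder only climbs one step and stays below the new leading term. -/
theorem IsDerivFlag.iteratedDeriv_eq (hg : IsDerivFlag I g M) (hI : IsOpen I) {η : ℝ → V}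
    {c : ℝ → ℝ} (hc : ContDiffOn ℝ ∞ c I) (hc0 : ∀ t ∈ I, c t ≠ 0)
    (hη : ∀ t ∈ I, η t = c t • g 0 t) {m : ℕ} (hm : m + 1 ≤ M) :
    ∃ b : ℝ → ℝ, ContDiffOn ℝ ∞ b I ∧ (∀ t ∈ I, b t ≠ 0) ∧ ∃ Y ∈ smoothCombinations I g m,
      ∀ t ∈ I, iteratedDeriv (m + 1) η t = b t • g (m + 1) t + Y t := by
  induction m with
  | zero =>
    obtain ⟨Y, hY, b, hb, hb0, h⟩ := hg.hasDerivAt_smul hI (show 0 < M by omega) hc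
    refine ⟨b, hb, fun t ht => hb0 t ht (hc0 t ht), Y, hY, fun t ht => ?_⟩
    rw [zero_add, iteratedDeriv_one]
    exact ((h t ht).congr_of_eventuallyEq (Filter.eventually_of_mem (hI.mem_nhds ht) hη)).deriv
  | succ m ih =>
    obtain ⟨b, hb, hb0, Y, hY, h⟩ := ih (by omega)
    obtain ⟨Z, hZ, b', hb', hb0', h'⟩ := hg.hasDerivAt_smul hI (show m + 1 < M by omega) hb
    obtain ⟨Y', hY', h2⟩ := hg.hasDerivAt_smoothCombinations hI (show m < M by omega) hY
    refine ⟨b', hb', fun t ht => hb0' t ht (hb0 t ht), Z + Y', Submodule.add_mem _ hZ hY',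
      fun t ht => ?_⟩
    rw [iteratedDeriv_succ]
    have := ((h' t ht).add (h2 t ht)).congr_of_eventuallyEq
      (Filter.eventually_of_mem (hI.mem_nhds ht) h)
    rw [this.deriv, Pi.add_apply, add_assoc]

theorem span_le_succ_eq (x : ℕ → V) (m : ℕ) :
    Submodule.span ℝ {v | ∃ l ≤ m + 1, v = x l} =
      Submodule.span ℝ {v | ∃ l ≤ m, v = x l} ⊔ Submodule.span ℝ {x (m + 1)} := by
  rw [← Submodule.span_union]
  congr 1
  ext v
  simp only [Set.mem_ofPred_eq, Set.union_singleton, Set.mem_insert_iff]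
  constructor
  · rintro ⟨l, hl, rfl⟩
    rcases Nat.le_succ_iff.1 hl with h | rfl
    · exact Or.inr ⟨l, h, rfl⟩
    · exact Or.inl rfl
  · rintro (rfl | ⟨l, hl, rfl⟩)
    · exact ⟨_, le_rfl, rfl⟩
    · exact ⟨l, by omega, rfl⟩

/-- The change from the flag to the derivatives is triangular with nonzero diagonal. -/
theorem IsDerivFlag.span_iteratedDeriv (hg : IsDerivFlag I g M) (hI : IsOpen I) {η : ℝ → V}
    {c : ℝ → ℝ} (hc : ContDiffOn ℝ ∞ c I) (hc0 : ∀ t ∈ I, c t ≠ 0)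
    (hη : ∀ t ∈ I, η t = c t • g 0 t) {m : ℕ} (hm : m ≤ M) {t : ℝ} (ht : t ∈ I) :
    Submodule.span ℝ {v | ∃ i ≤ m, v = iteratedDeriv i η t} =
      Submodule.span ℝ {v | ∃ l ≤ m, v = g l t} := by
  induction m with
  | zero =>
    simp only [Nat.le_zero, exists_eq_left, iteratedDeriv_zero, hη t ht]
    exact Submodule.span_singleton_smul_eq (IsUnit.mk0 _ (hc0 t ht)) _
  | succ m ih =>
    rw [span_le_succ_eq (fun i => iteratedDeriv i η t), span_le_succ_eq (fun l => g l t),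
      ih (by omega)]
    obtain ⟨b, -, hb0, Y, hY, h⟩ := hg.iteratedDeriv_eq hI hc hc0 hη hm
    have hYt := smoothCombinations_apply_mem hY t
    apply le_antisymm
    · refine sup_le le_sup_left ?_
      rw [Submodule.span_singleton_le_iff_mem, h t ht, add_comm (b t • _)]
      exact Submodule.add_mem_sup hYt
        (Submodule.smul_mem _ _ (Submodule.mem_span_singleton_self _))
    · refine sup_le le_sup_left ?_
      rw [Submodule.span_singleton_le_iff_mem]
      have h3 : g (m + 1) t = -((b t)⁻¹ • Y t) + (b t)⁻¹ • iteratedDeriv (m + 1) η t := by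
        rw [h t ht, smul_add, inv_smul_smul₀ (hb0 t ht)]
        abel
      rw [h3]
      exact Submodule.add_mem_sup (Submodule.neg_mem _ (Submodule.smul_mem _ _ hYt))
        (Submodule.smul_mem _ _ (Submodule.mem_span_singleton_self _))

end Flag

/-! ### Osculating spaces as orthogonal complements. -/

/-- The flag `e_0, e_1, e_{n+1}, e_2, e_3, …` of a conformal Frenet frame. -/
def frenetFlag (n : ℕ) {V : Type*} (e : ℕ → V) : ℕ → V
  | 0 => e 0
  | 1 => e 1
  | 2 => e (n + 1)
  | l + 3 => e (l + 2)

namespace ConformalFrenetSystem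

variable {n : ℕ} {I : Set ℝ} {e : ℕ → ℝ → Fin (n + 2) → ℝ} {w ψ : ℝ → ℝ} {m : ℕ → ℝ → ℝ}

/-- The leading coefficients are w three times and then m_2, …, m_{n-2}, all positive. Stopping at
step n, which is e_{n-1}, avoids dividing by m_{n-1}. -/
theorem isDerivFlag (H : ConformalFrenetSystem I e w ψ m) :
    IsDerivFlag I (frenetFlag n e) n := by
  intro l hl
  have hw : ∀ t ∈ I, w t ≠ 0 := fun t ht => (H.w_pos t ht).ne'
  have hm : ∀ k, 2 ≤ k → k + 2 ≤ n → ∀ t ∈ I, m k t ≠ 0 := fun k h1 h2 t ht =>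
    (H.m_pos t ht k h1 h2).ne'
  match l with
  | 0 => exact ⟨0, le_rfl, fun _ => 0, w, contDiffOn_const, H.smooth_w, hw,
      fun t ht => (H.deriv_zero t ht).congr_deriv (by simp [frenetFlag])⟩
  | 1 => exact ⟨0, by omega, ψ, w, H.smooth_ψ, H.smooth_w, hw, H.deriv_one⟩
  | 2 => exact ⟨1, by omega, ψ, w, H.smooth_ψ, H.smooth_w, hw, H.deriv_last⟩
  | 3 => exact ⟨0, by omega, w, m 2, H.smooth_w, H.smooth_m 2 (by omega), hm 2 le_rfl (by omega),
      H.deriv_two⟩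
  | l + 4 => exact ⟨l + 3, by omega, fun t => -m (l + 2) t, m (l + 3),
      (H.smooth_m _ (by omega)).neg, H.smooth_m _ (by omega), hm _ (by omega) (by omega),
      fun t ht => H.deriv_mid t ht (l + 3) (by omega) (by omega)⟩

theorem lorentzForm_flag_mid (H : ConformalFrenetSystem I e w ψ m) {t : ℝ} (ht : t ∈ I)
    {l a : ℕ} (hl : l ≤ a) (h2 : 2 ≤ a) (ha : a ≤ n) :
    lorentzForm n (frenetFlag n e l t) (e a t) = 0 := by
  match l with
  | 0 => exact H.zero_mid t ht a (by omega) ha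
  | 1 => exact (H.mid_mid t ht 1 a le_rfl (by omega) (by omega) ha).trans (if_neg (by omega))
  | 2 => exact H.last_mid t ht a (by omega) ha
  | l + 3 =>
    exact (H.mid_mid t ht _ a (by omega) (by omega) (by omega) ha).trans (if_neg (by omega))

theorem mem_span_flag_iff (H : ConformalFrenetSystem I e w ψ m) {t : ℝ} (ht : t ∈ I) {j : ℕ}
    (hj : 1 ≤ j) (X : Fin (n + 2) → ℝ) :
    X ∈ Submodule.span ℝ {v | ∃ l ≤ j + 1, v = frenetFlag n e l t} ↔
      ∀ a, j < a → a ≤ n → lorentzForm n X (e a t) = 0 := by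
  constructor
  · intro hX a h1 h2
    induction hX using Submodule.span_induction with
    | mem X hX =>
      obtain ⟨l, hl, rfl⟩ := hX
      exact H.lorentzForm_flag_mid ht (by omega) (by omega) h2
    | zero => simp
    | add X Y _ _ hx hy => simp [hx, hy]
    | smul c X _ hx => simp [hx]
  · intro h
    have mem : ∀ l ≤ j + 1, frenetFlag n e l t ∈
        Submodule.span ℝ {v | ∃ l ≤ j + 1, v = frenetFlag n e l t} := fun l hl =>
      Submodule.subset_span ⟨l, hl, rfl⟩
    rw [H.expand t ht X]
    refine Submodule.add_mem _ (Submodule.sub_mem _ (Submodule.smul_mem _ _ (mem 0 (by omega)))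
      (Submodule.smul_mem _ _ (mem 2 (by omega)))) (Submodule.sum_mem _ fun a ha => ?_)
    rw [Finset.mem_Icc] at ha
    by_cases haj : a ≤ j
    · refine Submodule.smul_mem _ _ ?_
      match a with
      | 1 => exact mem 1 (by omega)
      | a + 2 => exact mem (a + 3) (by omega)
    · rw [h a (by omega) ha.2, zero_smul]
      exact Submodule.zero_mem _

/-- The osculating space of a lift is the orthogonal complement of the last frame vectors. -/
theorem mem_osculatingSpace_iff (hI : IsOpen I) (H : ConformalFrenetSystem I e w ψ m)
    {η : ℝ → Fin (n + 2) → ℝ} (hη : ContDiffOn ℝ ∞ η I)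
    (hspan : ∀ t ∈ I, Submodule.span ℝ {η t} = Submodule.span ℝ {e 0 t})
    {j : ℕ} (hj : 1 ≤ j) (hjn : j + 1 ≤ n) {t : ℝ} (ht : t ∈ I) (X : Fin (n + 2) → ℝ) :
    X ∈ osculatingSpace η j t ↔ ∀ a, j < a → a ≤ n → lorentzForm n X (e a t) = 0 := by
  rw [← H.mem_span_flag_iff ht hj]
  -- The factor between the lift and e_0 is written as a Lorentzian product, which makes it smooth.
  -- If it vanished, e_0 would be zero.
  have h1 : ∀ t ∈ I, η t = (-lorentzForm n (η t) (e (n + 1) t)) • e 0 t := by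
    intro t ht
    obtain ⟨c, hc⟩ := Submodule.mem_span_singleton.1
      ((hspan t ht) ▸ Submodule.mem_span_singleton_self (η t))
    rw [← hc, map_smul, LinearMap.smul_apply, H.zero_last t ht]
    simp
  have h2 : ∀ t ∈ I, -lorentzForm n (η t) (e (n + 1) t) ≠ 0 := by
    intro t ht h0
    have h3 := h1 t ht
    rw [h0, zero_smul] at h3
    have h4 := hspan t ht
    rw [h3, Submodule.span_zero_singleton, eq_comm, Submodule.span_singleton_eq_bot] at h4
    have h5 := H.zero_last t ht
    rw [h4] at h5
    simp at h5
  unfold osculatingSpace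
  rw [(H.isDerivFlag).span_iteratedDeriv hI (hη.lorentzForm (H.smooth _)).neg h2 h1 hjn ht]

end ConformalFrenetSystem

/-! ### Lorentz-orthogonal projections and the trace invariant. -/

section TraceInvariant

variable {n : ℕ}

theorem eq_zero_of_lorentzForm_eq_zero {x : Fin (n + 2) → ℝ}
    (h : ∀ z, lorentzForm n z x = 0) : x = 0 := by
  have h1 : (lorentzMatrix n).mulVec x = 0 := by
    refine dotProduct_eq_zero _ fun z => ?_
    rw [dotProduct_comm, ← lorentzForm_eq_dotProduct, h]
  rw [← Matrix.one_mulVec x, ← lorentzMatrix_mul_self, ← Matrix.mulVec_mulVec, h1,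
    Matrix.mulVec_zero]

/-- The map `x ↦ ∑ ⟨x, a⟩ a`. -/
def orthoSum (S : Finset ℕ) (a : ℕ → Fin (n + 2) → ℝ) :
    (Fin (n + 2) → ℝ) →ₗ[ℝ] (Fin (n + 2) → ℝ) :=
  ∑ i ∈ S, (lorentzForm n (a i)).smulRight (a i)

theorem orthoSum_apply (S : Finset ℕ) (a : ℕ → Fin (n + 2) → ℝ) (x : Fin (n + 2) → ℝ) :
    orthoSum S a x = ∑ i ∈ S, lorentzForm n (a i) x • a i := by
  simp [orthoSum, LinearMap.sum_apply]

theorem lorentzForm_orthoSum {S : Finset ℕ} {a : ℕ → Fin (n + 2) → ℝ}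
    (ha : ∀ i ∈ S, ∀ j ∈ S, lorentzForm n (a i) (a j) = if i = j then 1 else 0) {i : ℕ}
    (hi : i ∈ S) (x : Fin (n + 2) → ℝ) :
    lorentzForm n (a i) (orthoSum S a x) = lorentzForm n (a i) x := by
  rw [orthoSum_apply, map_sum, Finset.sum_congr rfl (g := fun j => if i = j then
    lorentzForm n (a j) x else 0)]
  · simp [hi]
  · intro j hj
    rw [map_smul, smul_eq_mul, ha i hi j hj]
    simp

/-- Subtracting the expansion along an orthonormal family normal to V lands in V, and what is
subtracted is orthogonal to V. Nondegeneracy of the product makes this splitting direct, so the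
default value in `lorentzProj` does not occur. -/
theorem lorentzProj_eq {S : Finset ℕ} {a : ℕ → Fin (n + 2) → ℝ}
    (ha : ∀ i ∈ S, ∀ j ∈ S, lorentzForm n (a i) (a j) = if i = j then 1 else 0)
    {V : Submodule ℝ (Fin (n + 2) → ℝ)}
    (hV : ∀ x, x ∈ V ↔ ∀ i ∈ S, lorentzForm n (a i) x = 0) :
    lorentzProj V = LinearMap.id - orthoSum S a := by
  have h1 : ∀ x, x - orthoSum S a x ∈ V := by
    intro x
    rw [hV]
    intro i hi
    rw [map_sub, lorentzForm_orthoSum ha hi, sub_self]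
  have h2 : ∀ x, orthoSum S a x ∈ (lorentzForm n).orthogonal V := by
    intro x y hy
    rw [hV] at hy
    rw [orthoSum_apply, map_sum]
    refine Finset.sum_eq_zero fun i hi => ?_
    rw [map_smul, lorentzForm_comm y, hy i hi, smul_zero]
  have hc : IsCompl V ((lorentzForm n).orthogonal V) := by
    constructor
    · rw [Submodule.disjoint_def]
      intro x hx hx'
      refine eq_zero_of_lorentzForm_eq_zero fun z => ?_
      have h3 : z = (z - orthoSum S a z) + orthoSum S a z := by abel
      have h4 : lorentzForm n (z - orthoSum S a z) x = 0 := hx' _ (h1 z)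
      have h5 : lorentzForm n x (orthoSum S a z) = 0 := h2 z _ hx
      rw [h3, map_add, LinearMap.add_apply, h4, lorentzForm_comm, h5, add_zero]
    · rw [codisjoint_iff, eq_top_iff]
      intro x _
      have h3 : x = (x - orthoSum S a x) + orthoSum S a x := by abel
      rw [h3]
      exact Submodule.add_mem_sup (h1 x) (h2 x)
  refine LinearMap.ext fun x => ?_
  have h3 : x = (x - orthoSum S a x) + orthoSum S a x := by abel
  rw [lorentzProj, dif_pos hc]
  conv_lhs => rw [h3]
  rw [map_add, Submodule.projection_apply_of_mem_left hc (h1 x),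
    (Submodule.projection_apply_eq_zero_iff hc).2 (h2 x), add_zero]
  rfl

/-- Expand (id - P)(id - Q), with P and Q the projections onto the normal spaces: tr P = tr Q = |S|,
and tr PQ is the double sum. -/
theorem traceInvariant_eq {S : Finset ℕ} {a b : ℕ → Fin (n + 2) → ℝ}
    (ha : ∀ i ∈ S, ∀ j ∈ S, lorentzForm n (a i) (a j) = if i = j then 1 else 0)
    (hb : ∀ i ∈ S, ∀ j ∈ S, lorentzForm n (b i) (b j) = if i = j then 1 else 0)
    {V W : Submodule ℝ (Fin (n + 2) → ℝ)}
    (hV : ∀ x, x ∈ V ↔ ∀ i ∈ S, lorentzForm n (a i) x = 0)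
    (hW : ∀ x, x ∈ W ↔ ∀ i ∈ S, lorentzForm n (b i) x = 0) :
    traceInvariant V W = ((n : ℝ) + 2 - 2 * S.card) +
      ∑ i ∈ S, ∑ j ∈ S, lorentzForm n (a i) (b j) ^ 2 := by
  have htr : ∀ c : ℕ → Fin (n + 2) → ℝ,
      (∀ i ∈ S, ∀ j ∈ S, lorentzForm n (c i) (c j) = if i = j then 1 else 0) →
      LinearMap.trace ℝ _ (orthoSum S c) = S.card := by
    intro c hc
    rw [orthoSum, map_sum, Finset.sum_congr rfl (g := fun _ => (1 : ℝ))]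
    · simp
    · intro i hi
      rw [LinearMap.trace_smulRight, hc i hi i hi, if_pos rfl]
  have hcomp : orthoSum S a ∘ₗ orthoSum S b = ∑ i ∈ S, ∑ j ∈ S,
      lorentzForm n (a i) (b j) • (lorentzForm n (b j)).smulRight (a i) := by
    apply LinearMap.ext
    intro x
    simp only [LinearMap.comp_apply, orthoSum_apply, map_sum, LinearMap.sum_apply,
      LinearMap.smul_apply, LinearMap.smulRight_apply, map_smul, Finset.smul_sum, smul_smul]
    rw [Finset.sum_comm]
    refine Finset.sum_congr rfl fun i _ => Finset.sum_congr rfl fun j _ => ?_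
    rw [mul_comm]
  have h1 : (LinearMap.id - orthoSum S a) ∘ₗ (LinearMap.id - orthoSum S b) =
      LinearMap.id - orthoSum S a - orthoSum S b + orthoSum S a ∘ₗ orthoSum S b := by
    rw [LinearMap.sub_comp, LinearMap.comp_sub, LinearMap.comp_sub]
    simp only [LinearMap.id_comp, LinearMap.comp_id]
    abel
  rw [traceInvariant]
  -- The composite takes values in the image of W, so its trace there equals its trace on the whole
  -- space.
  refine (LinearMap.trace_restrict_eq_of_forall_mem _ _ ?_ _).trans ?_
  · exact fun x => Submodule.mem_map_of_mem (lorentzProj_mem W x)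
  · rw [lorentzProj_eq ha hV, lorentzProj_eq hb hW, h1, hcomp]
    simp only [map_add, map_sub, htr a ha, htr b hb, LinearMap.trace_id, map_sum, map_smul,
      LinearMap.trace_smulRight, Module.finrank_fin_fun, smul_eq_mul]
    push_cast
    rw [Finset.sum_congr rfl fun i _ => Finset.sum_congr rfl fun j _ => ?_]
    · ring
    · rw [lorentzForm_comm (b j), ← pow_two]

end TraceInvariant

/-! ### The second derivative of the trace invariant in the conformal arclength. -/

/-- Since s is strictly increasing on the interval, the inverse obtained by choice agrees near s t
with the smooth local inverse of the inverse function theorem. Its derivative comes from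
differentiating s(u(h)) = s t + h. -/
theorem eventually_hasDerivAt_invFunOn {I : Set ℝ} (hI : IsOpen I) (hI' : I.OrdConnected)
    {s w : ℝ → ℝ} (hs : ∀ t ∈ I, HasDerivAt s (w t) t) (hw : ContDiffOn ℝ ∞ w I)
    (hw0 : ∀ t ∈ I, 0 < w t) {t : ℝ} (ht : t ∈ I) :
    ContDiffAt ℝ ∞ (fun h => Function.invFunOn s I (s t + h)) 0 ∧
      Function.invFunOn s I (s t + 0) = t ∧
      ∀ᶠ h in nhds 0, Function.invFunOn s I (s t + h) ∈ I ∧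
        HasDerivAt (fun h => Function.invFunOn s I (s t + h))
          (w (Function.invFunOn s I (s t + h)))⁻¹ h := by
  have hinj : Set.InjOn s I := by
    refine (strictMonoOn_of_deriv_pos hI'.convex
      (fun x hx => (hs x hx).continuousAt.continuousWithinAt) ?_).injOn
    intro x hx
    rw [hI.interior_eq] at hx
    rw [(hs x hx).deriv]
    exact hw0 x hx
  have hsm : ContDiffOn ℝ ∞ s I := by
    rw [contDiffOn_infty_iff_deriv_of_isOpen hI]
    exact ⟨fun x hx => (hs x hx).differentiableAt.differentiableWithinAt,
      hw.congr fun x hx => (hs x hx).deriv⟩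
  have hsa : ContDiffAt ℝ ∞ s t := hsm.contDiffAt (hI.mem_nhds ht)
  have hd : HasFDerivAt s ((ContinuousLinearEquiv.unitsEquivAut ℝ (Units.mk0 (w t) (hw0 t ht).ne') :
      ℝ ≃L[ℝ] ℝ) : ℝ →L[ℝ] ℝ) t := by
    refine (hs t ht).hasFDerivAt.congr_fderiv ?_
    ext
    simp
  set φ := hsa.localInverse hd (by simp) with hφ
  have hφ1 : ContDiffAt ℝ ∞ φ (s t) := hsa.to_localInverse hd (by simp)
  have hφ2 : φ (s t) = t := hsa.localInverse_apply_image hd (by simp)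
  have hφ3 : ∀ᶠ y in nhds (s t), s (φ y) = y :=
    (hsa.hasStrictFDerivAt' hd (by simp)).eventually_right_inverse
  have hφ4 : ∀ᶠ y in nhds (s t), φ y ∈ I := by
    refine hφ1.continuousAt.eventually_mem ?_
    rw [hφ2]
    exact hI.mem_nhds ht
  have hlim : Filter.Tendsto (fun h => s t + h) (nhds 0) (nhds (s t)) := by
    have : ContinuousAt (fun h => s t + h) 0 := by fun_prop
    simpa [ContinuousAt] using this
  have hev : ∀ᶠ h in nhds 0, Function.invFunOn s I (s t + h) = φ (s t + h) := by
    filter_upwards [hlim.eventually hφ3, hlim.eventually hφ4] with h h3 h4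
    have hex : ∃ a ∈ I, s a = s t + h := ⟨_, h4, h3⟩
    exact hinj (Function.invFunOn_mem hex) h4 ((Function.invFunOn_eq hex).trans h3.symm)
  have hcd : ContDiffAt ℝ ∞ (fun h => Function.invFunOn s I (s t + h)) 0 := by
    refine ContDiffAt.congr_of_eventuallyEq ?_ hev
    refine ContDiffAt.comp (g := φ) (0 : ℝ) ?_ (by fun_prop)
    rwa [add_zero]
  refine ⟨hcd, by rw [hev.self_of_nhds, add_zero, hφ2], ?_⟩
  have hdiff : ∀ᶠ h in nhds 0,
      DifferentiableAt ℝ (fun h => Function.invFunOn s I (s t + h)) h :=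
    ((hcd.of_le (m := 1) (by simp)).eventually (by simp)).mono fun h hh =>
      hh.differentiableAt (by simp)
  have hinv : ∀ᶠ h in nhds 0, s (Function.invFunOn s I (s t + h)) = s t + h := by
    filter_upwards [hev, hlim.eventually hφ3] with h h2 h3
    rw [h2, h3]
  filter_upwards [hev, hlim.eventually hφ4, hdiff, hinv.eventually_nhds] with h h2 h4 h5 h6
  have hmem : Function.invFunOn s I (s t + h) ∈ I := by rw [h2]; exact h4
  refine ⟨hmem, ?_⟩
  have h7 := (hs _ hmem).comp h h5.hasDerivAt
  have h8 : HasDerivAt (s ∘ fun h => Function.invFunOn s I (s t + h)) 1 h :=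
    ((hasDerivAt_id h).const_add (s t)).congr_of_eventuallyEq h6
  have h9 := h7.unique h8
  rw [← eq_inv_of_mul_eq_one_right h9]
  exact h5.hasDerivAt

theorem sum_Icc_sub_pred (A : ℕ → ℝ) {j N : ℕ} (h : j ≤ N) :
    ∑ a ∈ Finset.Icc (j + 1) N, (A a - A (a - 1)) = A N - A j := by
  induction N, h using Nat.le_induction with
  | base => simp
  | succ N hN ih =>
    rw [Finset.sum_Icc_succ_top (by omega), ih]
    simp

namespace ConformalFrenetSystem

variable {n : ℕ} {I : Set ℝ} {e : ℕ → ℝ → Fin (n + 2) → ℝ} {w ψ : ℝ → ℝ} {m : ℕ → ℝ → ℝ}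

/-- The variable part of the trace invariant of the osculating spaces at `u` and `t`. -/
def overlap (n : ℕ) (e : ℕ → ℝ → Fin (n + 2) → ℝ) (j : ℕ) (t u : ℝ) : ℝ :=
  ∑ b ∈ Finset.Icc (j + 1) n, ∑ a ∈ Finset.Icc (j + 1) n, lorentzForm n (e a u) (e b t) ^ 2

/-- The derivative of `overlap`, up to the factor `-2 m_j`. -/
def overlapFlux (n : ℕ) (e : ℕ → ℝ → Fin (n + 2) → ℝ) (j : ℕ) (t u : ℝ) : ℝ :=
  ∑ b ∈ Finset.Icc (j + 1) n, lorentzForm n (e j u) (e b t) * lorentzForm n (e (j + 1) u) (e b t)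

theorem contDiffOn_overlap (H : ConformalFrenetSystem I e w ψ m) (j : ℕ) (t : ℝ) :
    ContDiffOn ℝ ∞ (overlap n e j t) I :=
  ContDiffOn.sum fun _ _ => ContDiffOn.sum fun a _ =>
    ((H.smooth a).lorentzForm contDiffOn_const).pow 2

/-- By the Frenet equations the sum over a is telescoping. The upper end vanishes because m_n = 0,
and the lower end is the term with m_j. As j ≥ 2, only the equations of e_a with a ≥ 3 are involved.
-/
theorem hasDerivAt_overlap (H : ConformalFrenetSystem I e w ψ m) {j : ℕ} (hj : 2 ≤ j)
    (hjn : j + 1 ≤ n) (t : ℝ) {u : ℝ} (hu : u ∈ I) :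
    HasDerivAt (overlap n e j t) (-2 * m j u * overlapFlux n e j t u) u := by
  have h1 : ∀ b ∈ Finset.Icc (j + 1) n, HasDerivAt
      (fun u => ∑ a ∈ Finset.Icc (j + 1) n, lorentzForm n (e a u) (e b t) ^ 2)
      (-2 * m j u * (lorentzForm n (e j u) (e b t) * lorentzForm n (e (j + 1) u) (e b t))) u := by
    intro b hb
    have h2 : ∀ a ∈ Finset.Icc (j + 1) n, HasDerivAt (fun u => lorentzForm n (e a u) (e b t) ^ 2)
        (2 * m a u * (lorentzForm n (e a u) (e b t) * lorentzForm n (e (a + 1) u) (e b t)) -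
        2 * m (a - 1) u * (lorentzForm n (e (a - 1) u) (e b t) *
          lorentzForm n (e (a - 1 + 1) u) (e b t))) u := by
      intro a ha
      rw [Finset.mem_Icc] at ha
      refine (((H.deriv_mid u hu a (by omega) ha.2).lorentzForm
        (hasDerivAt_const u (e b t))).fun_pow 2).congr_deriv ?_
      rw [Nat.sub_add_cancel (by omega)]
      simp only [map_add, map_smul, LinearMap.add_apply, LinearMap.smul_apply, map_zero,
        smul_eq_mul]
      ring
    refine (HasDerivAt.fun_sum h2).congr_deriv ?_
    rw [sum_Icc_sub_pred (fun a => 2 * m a u * (lorentzForm n (e a u) (e b t) *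
      lorentzForm n (e (a + 1) u) (e b t))) (by omega : j ≤ n), H.m_top u hu]
    ring
  refine (HasDerivAt.fun_sum h1).congr_deriv ?_
  rw [overlapFlux, Finset.mul_sum]

/-- Treats e_2 together with the later vectors: the exceptional e_0 term in its derivative is
orthogonal to e_3, …, e_n. -/
theorem exists_hasDerivAt_frame (H : ConformalFrenetSystem I e w ψ m) {j : ℕ} (hj : 2 ≤ j)
    (hjn : j + 1 ≤ n) {t : ℝ} (ht : t ∈ I) :
    ∃ v, HasDerivAt (e j) v t ∧ ∀ b, j + 1 ≤ b → b ≤ n →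
      lorentzForm n v (e b t) = if b = j + 1 then m j t else 0 := by
  rcases hj.eq_or_lt with rfl | h3
  · refine ⟨_, H.deriv_two t ht, fun b h1 h2 => ?_⟩
    simp only [map_add, map_smul, LinearMap.add_apply, LinearMap.smul_apply, smul_eq_mul]
    rw [H.zero_mid t ht b (by omega) h2, H.mid_mid t ht _ b (by omega) (by omega) (by omega) h2]
    grind
  · refine ⟨_, H.deriv_mid t ht j h3 (by omega), fun b h1 h2 => ?_⟩
    simp only [map_add, map_smul, LinearMap.add_apply, LinearMap.smul_apply, smul_eq_mul]
    rw [H.mid_mid t ht _ b (by omega) (by omega) (by omega) h2,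
      H.mid_mid t ht _ b (by omega) (by omega) (by omega) h2]
    grind

/-- At u = t the factor ⟨e_j, e_b⟩ is zero for b > j, so the derivative must fall on e_j; then only
b = j+1 contributes. -/
theorem hasDerivAt_overlapFlux (H : ConformalFrenetSystem I e w ψ m) {j : ℕ} (hj : 2 ≤ j)
    (hjn : j + 1 ≤ n) {t : ℝ} (ht : t ∈ I) :
    HasDerivAt (overlapFlux n e j t) (m j t) t := by
  obtain ⟨v, hv, hvb⟩ := H.exists_hasDerivAt_frame hj hjn ht
  have h1 : ∀ b ∈ Finset.Icc (j + 1) n, HasDerivAt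
      (fun u => lorentzForm n (e j u) (e b t) * lorentzForm n (e (j + 1) u) (e b t))
      (if b = j + 1 then m j t else 0) t := by
    intro b hb
    rw [Finset.mem_Icc] at hb
    refine ((hv.lorentzForm (hasDerivAt_const t (e b t))).fun_mul
      ((H.deriv_mid t ht (j + 1) (by omega) hjn).lorentzForm
        (hasDerivAt_const t (e b t)))).congr_deriv ?_
    rw [hvb b hb.1 hb.2, H.mid_mid t ht j b (by omega) (by omega) (by omega) hb.2,
      H.mid_mid t ht (j + 1) b (by omega) (by omega) (by omega) hb.2]
    simp only [map_zero]
    grind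
  refine (HasDerivAt.fun_sum h1).congr_deriv ?_
  simp [hjn]

theorem overlapFlux_self (H : ConformalFrenetSystem I e w ψ m) {j : ℕ} (hj : 2 ≤ j)
    {t : ℝ} (ht : t ∈ I) : overlapFlux n e j t t = 0 := by
  refine Finset.sum_eq_zero fun b hb => ?_
  rw [Finset.mem_Icc] at hb
  rw [H.mid_mid t ht j b (by omega) (by omega) (by omega) hb.2, if_neg (by omega), zero_mul]

theorem osculatingTrace_deriv (hI : IsOpen I) (hI' : I.OrdConnected)
    (H : ConformalFrenetSystem I e w ψ m) {s : ℝ → ℝ} (hs : ∀ t ∈ I, HasDerivAt s (w t) t)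
    {η : ℝ → Fin (n + 2) → ℝ} (hη : ContDiffOn ℝ ∞ η I)
    (hspan : ∀ t ∈ I, Submodule.span ℝ {η t} = Submodule.span ℝ {e 0 t})
    {j : ℕ} (hj : 2 ≤ j) (hjn : j + 1 ≤ n) {t : ℝ} (ht : t ∈ I) :
    ContDiffAt ℝ 2 (osculatingTrace I η s j t) 0 ∧
      iteratedDeriv 2 (osculatingTrace I η s j t) 0 = -2 * (m j t / w t) ^ 2 := by
  obtain ⟨hu, hu0, hev⟩ := eventually_hasDerivAt_invFunOn hI hI' hs H.smooth_w H.w_pos ht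
  set u := fun h => Function.invFunOn s I (s t + h) with hu_def
  have hu0' : u 0 = t := hu0
  have hmem : ∀ u ∈ I, ∀ x, x ∈ osculatingSpace η j u ↔
      ∀ i ∈ Finset.Icc (j + 1) n, lorentzForm n (e i u) x = 0 := by
    intro u hu x
    rw [H.mem_osculatingSpace_iff hI hη hspan (by omega) hjn hu]
    simp only [Finset.mem_Icc, lorentzForm_comm x, and_imp]
    exact Iff.rfl
  have hT : osculatingTrace I η s j t =ᶠ[nhds 0] fun h =>
      ((n : ℝ) + 2 - 2 * (Finset.Icc (j + 1) n).card) + overlap n e j t (u h) := by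
    filter_upwards [hev] with h hh
    have hon : ∀ v ∈ I, ∀ a ∈ Finset.Icc (j + 1) n, ∀ b ∈ Finset.Icc (j + 1) n,
        lorentzForm n (e a v) (e b v) = if a = b then 1 else 0 := by
      intro v hv a ha b hb
      rw [Finset.mem_Icc] at ha hb
      exact H.mid_mid v hv a b (by omega) ha.2 (by omega) hb.2
    rw [osculatingTrace, traceInvariant_eq (hon _ hh.1) (hon t ht) (hmem _ hh.1) (hmem t ht),
      overlap, Finset.sum_comm]
  have hmd : HasDerivAt (m j) (deriv (m j) t) t :=
    (((H.smooth_m j (by omega)).differentiableOn (by simp)).differentiableAt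
      (hI.mem_nhds ht)).hasDerivAt
  have hwd : HasDerivAt w (deriv w t) t :=
    ((H.smooth_w.differentiableOn (by simp)).differentiableAt (hI.mem_nhds ht)).hasDerivAt
  have hw0 := (H.w_pos t ht).ne'
  constructor
  · refine ContDiffAt.congr_of_eventuallyEq ?_ hT
    refine contDiffAt_const.add (ContDiffAt.comp (g := overlap n e j t) 0 ?_ (hu.of_le ENat.LEInfty.out))
    rw [hu0']
    exact ((H.contDiffOn_overlap j t).contDiffAt (hI.mem_nhds ht)).of_le ENat.LEInfty.out
  · have h1 : deriv (osculatingTrace I η s j t) =ᶠ[nhds 0] fun h =>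
        (fun v => -2 * m j v * overlapFlux n e j t v * (w v)⁻¹) (u h) := by
      filter_upwards [hT.eventuallyEq_nhds, hev] with h h2 h3
      rw [h2.deriv_eq]
      exact (((H.hasDerivAt_overlap hj hjn t h3.1).comp h h3.2).const_add _).deriv
    rw [iteratedDeriv_succ, iteratedDeriv_one, h1.deriv_eq]
    have h2 := hev.self_of_nhds.2
    -- The flux vanishes at t, so the derivatives of m_j and w drop out. One factor w⁻¹ is already
    -- in the first derivative, the other comes from the chain rule.
    have h3 := ((hmd.const_mul (-2)).fun_mul (H.hasDerivAt_overlapFlux hj hjn ht)).fun_mul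
      (hwd.fun_inv hw0)
    have hu0'' : Function.invFunOn s I (s t + 0) = t := hu0
    rw [hu0''] at h2
    have h4 := HasDerivAt.comp (0 : ℝ) (h₂ := fun v => -2 * m j v * overlapFlux n e j t v * (w v)⁻¹)
      (h := u) (by rw [hu0']; exact h3) h2
    refine h4.deriv.trans ?_
    rw [H.overlapFlux_self hj ht]
    field_simp
    ring

end ConformalFrenetSystem

/-! ### Euclidean Frenet frames in Lorentz space and the vectors of osculating spheres. -/

/-- A curve of Lorentz frames `D, h_1, …, h_n, N` over `I` with constant null vector `N`, which is
the lift of the Euclidean Frenet frame of a curve with speed `v` and curvatures `κ_1, …, κ_{n-1}`.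
By convention `h_{n+1} = 0`. -/
structure EuclideanFrenetSystem {n : ℕ} (I : Set ℝ) (D : ℝ → Fin (n + 2) → ℝ)
    (h : ℕ → ℝ → Fin (n + 2) → ℝ) (N : Fin (n + 2) → ℝ) (v : ℝ → ℝ) (κ : ℕ → ℝ → ℝ) : Prop where
  smooth_v : ContDiffOn ℝ ∞ v I
  smooth_κ : ∀ a, 1 ≤ a → a + 1 ≤ n → ContDiffOn ℝ ∞ (κ a) I
  v_pos : ∀ t ∈ I, 0 < v t
  κ_ne : ∀ t ∈ I, ∀ a, 1 ≤ a → a + 1 ≤ n → κ a t ≠ 0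
  point_point : ∀ t ∈ I, lorentzForm n (D t) (D t) = 0
  infty_infty : lorentzForm n N N = 0
  point_infty : ∀ t ∈ I, lorentzForm n (D t) N = -1
  point_mid : ∀ t ∈ I, ∀ a, lorentzForm n (D t) (h a t) = 0
  infty_mid : ∀ t ∈ I, ∀ a, lorentzForm n N (h a t) = 0
  mid_mid : ∀ t ∈ I, ∀ a b, 1 ≤ a → a ≤ n → 1 ≤ b →
    lorentzForm n (h a t) (h b t) = if a = b then 1 else 0
  top : ∀ t ∈ I, h (n + 1) t = 0
  deriv_point : ∀ t ∈ I, HasDerivAt D (v t • h 1 t) t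
  deriv_one : ∀ t ∈ I, HasDerivAt (h 1) (v t • (κ 1 t • h 2 t + N)) t
  deriv_mid : ∀ t ∈ I, ∀ a, 2 ≤ a → a ≤ n →
    HasDerivAt (h a) (v t • (-κ (a - 1) t • h (a - 1) t + κ a t • h (a + 1) t)) t

/-- The components of the centres of the osculating spheres in the Frenet frame, for a curve with
speed `v` and curvatures `κ_1, κ_2, …`. -/
noncomputable def centreComponent (v : ℝ → ℝ) (κ : ℕ → ℝ → ℝ) : ℕ → ℝ → ℝ
  | 0 => 0
  | 1 => 0
  | 2 => fun t => (κ 1 t)⁻¹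
  | a + 3 => fun t => (deriv (centreComponent v κ (a + 2)) t / v t +
      κ (a + 1) t * centreComponent v κ (a + 1) t) / κ (a + 2) t

/-- The Euclidean speed of `centreComponent` relative to the moving frame. -/
noncomputable def centreSpeed (v : ℝ → ℝ) (κ : ℕ → ℝ → ℝ) (a : ℕ) (t : ℝ) : ℝ :=
  deriv (centreComponent v κ a) t / v t + κ (a - 1) t * centreComponent v κ (a - 1) t

/-- The vector, orthogonal to the osculating `i`-sphere, which represents the hypersphere with the
same centre and radius. -/
def sphereVec {n : ℕ} (D : ℝ → Fin (n + 2) → ℝ) (h : ℕ → ℝ → Fin (n + 2) → ℝ) (p : ℕ → ℝ → ℝ)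
    (i : ℕ) (t : ℝ) : Fin (n + 2) → ℝ :=
  D t + ∑ a ∈ Finset.Icc 2 (i + 1), p a t • h a t

/-- The squared radius of the osculating `i`-sphere. -/
def radiusSq (p : ℕ → ℝ → ℝ) (i : ℕ) (t : ℝ) : ℝ :=
  ∑ a ∈ Finset.Icc 2 (i + 1), p a t ^ 2

theorem sphereVec_succ {n : ℕ} (D : ℝ → Fin (n + 2) → ℝ) (h : ℕ → ℝ → Fin (n + 2) → ℝ)
    (p : ℕ → ℝ → ℝ) (i : ℕ) (t : ℝ) :
    sphereVec D h p (i + 1) t = sphereVec D h p i t + p (i + 2) t • h (i + 2) t := by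
  rw [sphereVec, sphereVec, Finset.sum_Icc_succ_top (by omega)]
  exact (add_assoc _ _ _).symm

theorem radiusSq_succ (p : ℕ → ℝ → ℝ) (i : ℕ) (t : ℝ) :
    radiusSq p (i + 1) t = radiusSq p i t + p (i + 2) t ^ 2 := by
  rw [radiusSq, radiusSq, Finset.sum_Icc_succ_top (by omega)]

namespace EuclideanFrenetSystem

variable {n : ℕ} {I : Set ℝ} {D : ℝ → Fin (n + 2) → ℝ} {h : ℕ → ℝ → Fin (n + 2) → ℝ}
  {N : Fin (n + 2) → ℝ} {v : ℝ → ℝ} {κ : ℕ → ℝ → ℝ}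

theorem centreSpeed_eq (H : EuclideanFrenetSystem I D h N v κ) {t : ℝ} (ht : t ∈ I) {a : ℕ}
    (ha : 2 ≤ a) (han : a + 1 ≤ n) :
    centreSpeed v κ a t = κ a t * centreComponent v κ (a + 1) t := by
  obtain ⟨a, rfl⟩ : ∃ b, a = b + 2 := ⟨a - 2, by omega⟩
  rw [centreSpeed, centreComponent, mul_div_cancel₀ _ (H.κ_ne t ht (a + 2) (by omega) han)]
  rfl

/-- Up to a = n the recursion divides only by v and κ_1, …, κ_{n-1}, none of which vanishes. -/
theorem contDiffOn_centreComponent (hI : IsOpen I) (H : EuclideanFrenetSystem I D h N v κ) (a : ℕ)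
    (ha : a ≤ n) : ContDiffOn ℝ ∞ (centreComponent v κ a) I := by
  induction a using Nat.strong_induction_on with
  | _ a ih =>
  match a with
  | 0 => exact contDiffOn_const
  | 1 => exact contDiffOn_const
  | 2 => exact (H.smooth_κ 1 le_rfl ha).inv fun t ht => H.κ_ne t ht 1 le_rfl ha
  | a + 3 =>
    have h1 := ih (a + 2) (by omega) (by omega)
    have h2 := ih (a + 1) (by omega) (by omega)
    have h3 := ((contDiffOn_infty_iff_deriv_of_isOpen hI).1 h1).2
    exact ((h3.div H.smooth_v fun t ht => (H.v_pos t ht).ne').add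
      ((H.smooth_κ (a + 1) (by omega) (by omega)).mul h2)).div
      (H.smooth_κ (a + 2) (by omega) (by omega)) fun t ht => H.κ_ne t ht _ (by omega) (by omega)

theorem hasDerivAt_centreComponent (hI : IsOpen I) (H : EuclideanFrenetSystem I D h N v κ) {a : ℕ}
    (ha : a ≤ n) {t : ℝ} (ht : t ∈ I) :
    HasDerivAt (centreComponent v κ a)
      (v t * (centreSpeed v κ a t - κ (a - 1) t * centreComponent v κ (a - 1) t)) t := by
  have h1 := (((H.contDiffOn_centreComponent hI a ha).differentiableOn (by simp)).differentiableAt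
    (hI.mem_nhds ht)).hasDerivAt
  refine h1.congr_deriv ?_
  have := (H.v_pos t ht).ne'
  rw [centreSpeed, add_sub_cancel_right]
  field_simp

theorem radiusSq_pos (H : EuclideanFrenetSystem I D h N v κ) (hn : 2 ≤ n) {t : ℝ} (ht : t ∈ I)
    {i : ℕ} (hi : 1 ≤ i) : 0 < radiusSq (centreComponent v κ) i t := by
  refine lt_of_lt_of_le ?_ (Finset.single_le_sum (fun a _ => sq_nonneg _)
    (Finset.mem_Icc.2 ⟨le_rfl, (by omega : 2 ≤ i + 1)⟩))
  exact sq_pos_of_ne_zero (inv_ne_zero (H.κ_ne t ht 1 le_rfl hn))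

/-- The recursion for the components cancels all lower terms, so this vector stays orthogonal to the
osculating space to the required order of contact. -/
theorem hasDerivAt_sphereVec (hI : IsOpen I) (H : EuclideanFrenetSystem I D h N v κ) {i : ℕ}
    (hi : 1 ≤ i) (hin : i + 1 ≤ n) {t : ℝ} (ht : t ∈ I) :
    HasDerivAt (sphereVec D h (centreComponent v κ) i)
      (v t • (centreSpeed v κ (i + 1) t • h (i + 1) t +
        (centreComponent v κ (i + 1) t * κ (i + 1) t) • h (i + 2) t)) t := by
  have step : ∀ a, 2 ≤ a → a ≤ n →
      HasDerivAt (fun t => centreComponent v κ a t • h a t) _ t := fun a ha1 ha2 =>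
    (H.hasDerivAt_centreComponent hI ha2 ht).fun_smul (H.deriv_mid t ht a ha1 ha2)
  induction i, hi using Nat.le_induction with
  | base =>
    have h1 : sphereVec D h (centreComponent v κ) 1 =
        fun t => D t + centreComponent v κ 2 t • h 2 t := by
      ext1 t; simp [sphereVec]
    rw [h1]
    refine ((H.deriv_point t ht).fun_add (step 2 le_rfl hin)).congr_deriv ?_
    -- The value p_2 = 1/κ_1 is what cancels the velocity v h_1 of D.
    have h2 : centreComponent v κ 2 t * κ 1 t = 1 :=
      inv_mul_cancel₀ (H.κ_ne t ht 1 le_rfl hin)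
    have h3 : centreComponent v κ 1 t = 0 := rfl
    simp only [Nat.add_one_sub_one, h3, mul_zero, sub_zero, Nat.reduceAdd]
    match_scalars
    · linear_combination (-v t) * h2
    · ring
    · ring
  | succ i hi ih =>
    have h1 : sphereVec D h (centreComponent v κ) (i + 1) = fun t =>
        sphereVec D h (centreComponent v κ) i t + centreComponent v κ (i + 2) t • h (i + 2) t := by
      ext1 t; rw [sphereVec_succ]
    rw [h1]
    refine ((ih (by omega)).fun_add (step (i + 2) (by omega) hin)).congr_deriv ?_
    -- The recursion turns the h_{i+1} coefficient of Y_i' into κ_{i+1} p_{i+2}, cancelled by the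
    -- backward term of h_{i+2}'.
    rw [H.centreSpeed_eq ht (by omega : 2 ≤ i + 1) hin]
    simp only [show i + 2 - 1 = i + 1 by omega, show i + 1 + 1 = i + 2 by omega]
    module

theorem lorentzForm_sphereVec_mid (H : EuclideanFrenetSystem I D h N v κ) {t : ℝ} (ht : t ∈ I)
    {i b : ℕ} (hin : i + 1 ≤ n) (hb : 1 ≤ b) :
    lorentzForm n (sphereVec D h (centreComponent v κ) i t) (h b t) =
      if 2 ≤ b ∧ b ≤ i + 1 then centreComponent v κ b t else 0 := by
  rw [sphereVec, map_add, LinearMap.add_apply, H.point_mid t ht, lorentzForm_sum_smul_left,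
    Finset.sum_congr rfl (g := fun a => if b = a then centreComponent v κ a t else 0)]
  · rw [Finset.sum_ite_eq, zero_add]
    simp only [Finset.mem_Icc]
  · intro a ha
    rw [Finset.mem_Icc] at ha
    rw [H.mid_mid t ht a b (by omega) (by omega) hb]
    simp [eq_comm]

/-- D is null and orthogonal to every h_a, so only the common components p_2, …, p_{i+1} count. -/
theorem lorentzForm_sphereVec (H : EuclideanFrenetSystem I D h N v κ) {t : ℝ} (ht : t ∈ I)
    {i j : ℕ} (hij : i ≤ j) (hj : j + 1 ≤ n) :
    lorentzForm n (sphereVec D h (centreComponent v κ) i t)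
      (sphereVec D h (centreComponent v κ) j t) = radiusSq (centreComponent v κ) i t := by
  have hD : lorentzForm n (D t) (sphereVec D h (centreComponent v κ) j t) = 0 := by
    rw [sphereVec, map_add, H.point_point t ht, map_sum, zero_add]
    refine Finset.sum_eq_zero fun a _ => ?_
    rw [map_smul, H.point_mid t ht, smul_zero]
  conv_lhs => rw [sphereVec]
  rw [map_add, LinearMap.add_apply, hD, lorentzForm_sum_smul_left, zero_add, radiusSq]
  refine Finset.sum_congr rfl fun a ha => ?_
  rw [Finset.mem_Icc] at ha
  rw [lorentzForm_comm, H.lorentzForm_sphereVec_mid ht hj (by omega), if_pos (by omega), pow_two]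

end EuclideanFrenetSystem

/-! ### The conformal normals expressed in the Euclidean frame. -/

/-- A multiple of the vector `e_a` of the conformal Frenet frame, in terms of the Euclidean one. -/
noncomputable def normalVec {n : ℕ} (D : ℝ → Fin (n + 2) → ℝ) (h : ℕ → ℝ → Fin (n + 2) → ℝ)
    (p : ℕ → ℝ → ℝ) (a : ℕ) (t : ℝ) : Fin (n + 2) → ℝ :=
  if a = n then sphereVec D h p (a - 1) t
  else p (a + 1) t • sphereVec D h p (a - 1) t - radiusSq p (a - 1) t • h (a + 1) t

/-- The squared length of `normalVec`. -/
def normalSq (n : ℕ) (p : ℕ → ℝ → ℝ) (a : ℕ) (t : ℝ) : ℝ :=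
  if a = n then radiusSq p (a - 1) t else radiusSq p (a - 1) t * radiusSq p a t

section NormalVec

variable {n : ℕ} {I : Set ℝ} {D : ℝ → Fin (n + 2) → ℝ} {h : ℕ → ℝ → Fin (n + 2) → ℝ}
  {N : Fin (n + 2) → ℝ} {v : ℝ → ℝ} {κ : ℕ → ℝ → ℝ}

namespace EuclideanFrenetSystem

/-- The Gram-Schmidt cancellation: Y_i pairs with Y_{a-1} to R_{a-1} and with h_{a+1} to p_{a+1}. -/
theorem normalVec_sphereVec (H : EuclideanFrenetSystem I D h N v κ) {t : ℝ} (ht : t ∈ I)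
    {a i : ℕ} (ha : 2 ≤ a) (hai : a ≤ i) (hi : i + 1 ≤ n) :
    lorentzForm n (normalVec D h (centreComponent v κ) a t)
      (sphereVec D h (centreComponent v κ) i t) = 0 := by
  rw [normalVec, if_neg (by omega)]
  simp only [map_sub, map_smul, LinearMap.sub_apply, LinearMap.smul_apply, smul_eq_mul]
  rw [H.lorentzForm_sphereVec ht (by omega) hi, lorentzForm_comm,
    H.lorentzForm_sphereVec_mid ht hi (by omega), if_pos (by omega)]
  ring

theorem normalVec_mid (H : EuclideanFrenetSystem I D h N v κ) {t : ℝ} (ht : t ∈ I)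
    {a c : ℕ} (ha : 2 ≤ a) (han : a < n) (hc : a < c) :
    lorentzForm n (normalVec D h (centreComponent v κ) a t) (h c t) =
      if c = a + 1 then -radiusSq (centreComponent v κ) (a - 1) t else 0 := by
  rw [normalVec, if_neg (by omega)]
  simp only [map_sub, map_smul, LinearMap.sub_apply, LinearMap.smul_apply, smul_eq_mul]
  rw [H.lorentzForm_sphereVec_mid ht (by omega) (by omega), if_neg (by omega),
    H.mid_mid t ht _ _ (by omega) (by omega) (by omega)]
  grind

theorem normalVec_normalVec (H : EuclideanFrenetSystem I D h N v κ) {t : ℝ} (ht : t ∈ I)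
    {a b : ℕ} (ha : 2 ≤ a) (hab : a < b) (hb : b ≤ n) :
    lorentzForm n (normalVec D h (centreComponent v κ) a t)
      (normalVec D h (centreComponent v κ) b t) = 0 := by
  have h1 := H.normalVec_sphereVec ht ha (i := b - 1) (by omega) (by omega)
  conv_lhs => arg 2; rw [normalVec]
  split_ifs with hbn
  · exact h1
  · rw [map_sub, map_smul, map_smul, h1, H.normalVec_mid ht ha (by omega) (by omega),
      if_neg (by omega)]
    simp

theorem normalVec_self (H : EuclideanFrenetSystem I D h N v κ) {t : ℝ} (ht : t ∈ I)
    {a : ℕ} (ha : 2 ≤ a) (han : a ≤ n) :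
    lorentzForm n (normalVec D h (centreComponent v κ) a t)
      (normalVec D h (centreComponent v κ) a t) = normalSq n (centreComponent v κ) a t := by
  by_cases hn : a = n
  · rw [normalVec, if_pos hn, normalSq, if_pos hn,
      H.lorentzForm_sphereVec ht le_rfl (by omega)]
  · conv_lhs => arg 2; rw [normalVec, if_neg hn]
    rw [map_sub, map_smul, map_smul, H.normalVec_mid ht ha (by omega) (by omega), if_pos rfl,
      normalSq, if_neg hn, normalVec, if_neg hn]
    simp only [map_sub, map_smul, LinearMap.sub_apply, LinearMap.smul_apply, smul_eq_mul]
    rw [H.lorentzForm_sphereVec ht le_rfl (by omega), lorentzForm_comm (h _ t),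
      H.lorentzForm_sphereVec_mid ht (by omega) (by omega), if_neg (by omega)]
    obtain ⟨b, rfl⟩ : ∃ b, a = b + 1 := ⟨a - 1, by omega⟩
    rw [radiusSq_succ]
    simp only [Nat.add_sub_cancel]
    ring

theorem normalSq_pos (H : EuclideanFrenetSystem I D h N v κ) {t : ℝ} (ht : t ∈ I)
    {a : ℕ} (ha : 2 ≤ a) (han : a ≤ n) : 0 < normalSq n (centreComponent v κ) a t := by
  have h1 := H.radiusSq_pos (by omega) ht (by omega : 1 ≤ a - 1)
  have h2 := H.radiusSq_pos (by omega) ht (by omega : 1 ≤ a)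
  rw [normalSq]
  split_ifs
  · exact h1
  · exact mul_pos h1 h2

end EuclideanFrenetSystem

variable {e : ℕ → ℝ → Fin (n + 2) → ℝ} {w ψ : ℝ → ℝ} {m : ℕ → ℝ → ℝ}

/-- Induction along the flag g_l: if g_l is orthogonal to X along I, then ⟨g_l', X⟩ = -⟨g_l, X'⟩.
For X = h_a or Y_i the derivative X' involves only vectors h_b already orthogonal to g_l, so the
leading term g_{l+1} of g_l' is orthogonal to X. -/
theorem frenetFlag_orthogonal (hI : IsOpen I) (C : ConformalFrenetSystem I e w ψ m)
    (H : EuclideanFrenetSystem I D h N v κ) {c : ℝ → ℝ} (hc : ∀ t ∈ I, e 0 t = c t • D t)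
    {l : ℕ} (hl : l ≤ n) {t : ℝ} (ht : t ∈ I) :
    (∀ a, l + 1 ≤ a → a ≤ n + 1 → lorentzForm n (frenetFlag n e l t) (h a t) = 0) ∧
    ∀ i, 1 ≤ i → l ≤ i + 1 → i + 1 ≤ n →
      lorentzForm n (frenetFlag n e l t) (sphereVec D h (centreComponent v κ) i t) = 0 := by
  induction l using Nat.strong_induction_on generalizing t with
  | _ l ih =>
  match l with
  | 0 =>
    constructor
    · intro a _ _
      rw [frenetFlag, hc t ht, map_smul, LinearMap.smul_apply, H.point_mid t ht, smul_zero]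
    · intro i _ _ _
      rw [frenetFlag, hc t ht, map_smul, LinearMap.smul_apply, sphereVec, map_add,
        H.point_point t ht, map_sum, Finset.sum_eq_zero, add_zero, smul_zero]
      intro a _
      rw [map_smul, H.point_mid t ht, smul_zero]
  | l + 1 =>
    obtain ⟨p, hp, a, b, -, -, hb0, hd⟩ := C.isDerivFlag l (by omega)
    have key : ∀ (X : ℝ → Fin (n + 2) → ℝ) (X' : Fin (n + 2) → ℝ), HasDerivAt X X' t →
        (∀ u ∈ I, lorentzForm n (frenetFlag n e l u) (X u) = 0) →
        lorentzForm n (frenetFlag n e p t) (X t) = 0 →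
        lorentzForm n (frenetFlag n e l t) X' = 0 →
        lorentzForm n (frenetFlag n e (l + 1) t) (X t) = 0 := by
      intro X X' hX h1 h2 h3
      have h4 := lorentzForm_deriv_eq_neg hI ht h1 (hd t ht) hX
      rw [h3, map_add, map_smul, map_smul, LinearMap.add_apply, LinearMap.smul_apply,
        LinearMap.smul_apply, h2, smul_zero, zero_add, neg_zero, smul_eq_mul] at h4
      exact (mul_eq_zero.1 h4).resolve_left (hb0 t ht)
    constructor
    · intro c h1 h2
      rcases Nat.lt_or_ge n c with h3 | h3
      · obtain rfl : c = n + 1 := by omega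
        rw [H.top t ht, map_zero]
      · refine key (h c) _ (H.deriv_mid t ht c (by omega) h3)
          (fun u hu => (ih l (by omega) (by omega) hu).1 c (by omega) h2)
          ((ih p (by omega) (by omega) ht).1 c (by omega) h2) ?_
        rw [map_smul, map_add, map_smul, map_smul,
          (ih l (by omega) (by omega) ht).1 (c - 1) (by omega) (by omega),
          (ih l (by omega) (by omega) ht).1 (c + 1) (by omega) (by omega)]
        simp
    · intro i h1 h2 h3
      refine key _ _ (H.hasDerivAt_sphereVec hI h1 h3 ht)
        (fun u hu => (ih l (by omega) (by omega) hu).2 i h1 (by omega) h3)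
        ((ih p (by omega) (by omega) ht).2 i h1 (by omega) h3) ?_
      rw [map_smul, map_add, map_smul, map_smul,
        (ih l (by omega) (by omega) ht).1 (i + 1) (by omega) (by omega),
        (ih l (by omega) (by omega) ht).1 (i + 2) (by omega) (by omega)]
      simp

theorem ConformalFrenetSystem.eq_smul_of_orthogonal (C : ConformalFrenetSystem I e w ψ m) {t : ℝ}
    (ht : t ∈ I) {a : ℕ} (ha : 2 ≤ a) (han : a ≤ n) {X : Fin (n + 2) → ℝ}
    (h1 : ∀ l ≤ a, lorentzForm n (frenetFlag n e l t) X = 0)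
    (h2 : ∀ b, a < b → b ≤ n → lorentzForm n X (e b t) = 0) :
    X = lorentzForm n X (e a t) • e a t := by
  have h0 : lorentzForm n X (e 0 t) = 0 := by rw [lorentzForm_comm]; exact h1 0 (by omega)
  have h3 : lorentzForm n X (e (n + 1) t) = 0 := by rw [lorentzForm_comm]; exact h1 2 ha
  conv_lhs => rw [C.expand t ht X]
  rw [h0, h3, neg_zero, zero_smul, zero_smul, sub_zero, zero_add]
  refine Finset.sum_eq_single_of_mem a (Finset.mem_Icc.2 ⟨by omega, han⟩) fun b hb hba => ?_
  rw [Finset.mem_Icc] at hb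
  rcases Nat.lt_or_gt_of_ne hba with h4 | h4
  · rw [lorentzForm_comm]
    match b with
    | 1 => rw [show lorentzForm n (e 1 t) X = 0 from h1 1 (by omega), zero_smul]
    | b + 2 => rw [show lorentzForm n (e (b + 2) t) X = 0 from h1 (b + 3) (by omega), zero_smul]
  · rw [h2 b h4 hb.2, zero_smul]

/-- The vectors `normalVec` are multiples of those of the conformal Frenet frame. -/
theorem normalVec_eq_smul (hI : IsOpen I) (C : ConformalFrenetSystem I e w ψ m)
    (H : EuclideanFrenetSystem I D h N v κ) {c : ℝ → ℝ} (hc : ∀ t ∈ I, e 0 t = c t • D t)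
    {t : ℝ} (ht : t ∈ I) {a : ℕ} (ha : 2 ≤ a) (han : a ≤ n) :
    ∃ β : ℝ, β ^ 2 = normalSq n (centreComponent v κ) a t ∧
      normalVec D h (centreComponent v κ) a t = β • e a t := by
  -- Descending induction on a: orthogonality to e_b for b > a comes from the proportionality of B_b
  -- and e_b already established, and orthogonality to the earlier vectors from the flag.
  obtain ⟨k, hk⟩ : ∃ k, k = n - a := ⟨_, rfl⟩
  induction k using Nat.strong_induction_on generalizing a with
  | _ k ih =>
  have h1 : ∀ l ≤ a, lorentzForm n (frenetFlag n e l t)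
      (normalVec D h (centreComponent v κ) a t) = 0 := by
    intro l hl
    obtain ⟨h2, h3⟩ := frenetFlag_orthogonal hI C H hc (by omega : l ≤ n) ht
    have h4 := h3 (a - 1) (by omega) (by omega) (by omega)
    rw [normalVec]
    split_ifs with hn
    · exact h4
    · rw [map_sub, map_smul, map_smul, h4, h2 (a + 1) (by omega) (by omega)]
      simp
  have h2 : ∀ b, a < b → b ≤ n →
      lorentzForm n (normalVec D h (centreComponent v κ) a t) (e b t) = 0 := by
    intro b hab hb
    obtain ⟨β, hβ, heq⟩ := ih (n - b) (by omega) (by omega : 2 ≤ b) hb rfl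
    have h3 := H.normalVec_normalVec ht ha hab hb
    have hβ0 : β ≠ 0 := by
      rintro rfl
      have := H.normalSq_pos ht (by omega : 2 ≤ b) hb
      rw [← hβ] at this
      simp at this
    rw [heq, map_smul, smul_eq_mul] at h3
    exact (mul_eq_zero.1 h3).resolve_left hβ0
  have h3 := C.eq_smul_of_orthogonal ht ha han h1 h2
  refine ⟨_, ?_, h3⟩
  have h4 := congrArg (lorentzForm n (normalVec D h (centreComponent v κ) a t)) h3
  rw [map_smul, smul_eq_mul, H.normalVec_self ht ha han] at h4
  rw [h4, pow_two]

end NormalVec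

/-! ### Conformal curvatures and conformal speed in Euclidean terms. -/

section Curvatures

variable {n : ℕ} {I : Set ℝ} {D : ℝ → Fin (n + 2) → ℝ} {h : ℕ → ℝ → Fin (n + 2) → ℝ}
  {N : Fin (n + 2) → ℝ} {v : ℝ → ℝ} {κ : ℕ → ℝ → ℝ}
  {e : ℕ → ℝ → Fin (n + 2) → ℝ} {w ψ : ℝ → ℝ} {m : ℕ → ℝ → ℝ}

/-- Write B_j = α e_j and B_{j+1} = β e_{j+1} at t. Differentiating ⟨e_j, B_{j+1}⟩ = 0 gives ⟨e_j,
B_{j+1}'⟩ = -β m_j without differentiating β, which is known only pointwise and up to sign. -/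
theorem sq_mul_normalSq (hI : IsOpen I) (C : ConformalFrenetSystem I e w ψ m)
    (H : EuclideanFrenetSystem I D h N v κ) {c : ℝ → ℝ} (hc : ∀ t ∈ I, e 0 t = c t • D t)
    {t : ℝ} (ht : t ∈ I) {j : ℕ} (hj : 2 ≤ j) (hjn : j + 1 ≤ n) {B' : Fin (n + 2) → ℝ}
    (hB' : HasDerivAt (normalVec D h (centreComponent v κ) (j + 1)) B' t) :
    m j t ^ 2 * normalSq n (centreComponent v κ) j t * normalSq n (centreComponent v κ) (j + 1) t =
      lorentzForm n (normalVec D h (centreComponent v κ) j t) B' ^ 2 := by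
  obtain ⟨v', hv', hvb⟩ := C.exists_hasDerivAt_frame hj hjn ht
  have h0 : ∀ u ∈ I, lorentzForm n (e j u) (normalVec D h (centreComponent v κ) (j + 1) u) = 0 := by
    intro u hu
    obtain ⟨β, -, hβ⟩ := normalVec_eq_smul hI C H hc hu (by omega : 2 ≤ j + 1) hjn
    rw [hβ, map_smul, C.mid_mid u hu _ _ (by omega) (by omega) (by omega) hjn, if_neg (by omega),
      smul_zero]
  have h1 := lorentzForm_deriv_eq_neg hI ht h0 hv' hB'
  obtain ⟨β, hβ2, hβ⟩ := normalVec_eq_smul hI C H hc ht (by omega : 2 ≤ j + 1) hjn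
  obtain ⟨α, hα2, hα⟩ := normalVec_eq_smul hI C H hc ht hj (by omega)
  rw [hβ, map_smul, hvb _ le_rfl hjn, if_pos rfl, smul_eq_mul] at h1
  rw [← hβ2, ← hα2, hα, map_smul, LinearMap.smul_apply, smul_eq_mul,
    show lorentzForm n (e j t) B' = -(β * m j t) by linarith]
  ring

/-- The pairing ⟨B_j, B_{j+1}'⟩ is -v κ_{j+1} R_{j-1} (R_j + p_{j+2}²) = -v κ_{j+1} R_{j-1} R_{j+1};
a common factor R_{j-1} R_{j+1} then cancels. -/
theorem curvature_sq_mid (hI : IsOpen I) (C : ConformalFrenetSystem I e w ψ m)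
    (H : EuclideanFrenetSystem I D h N v κ) {c : ℝ → ℝ} (hc : ∀ t ∈ I, e 0 t = c t • D t)
    {t : ℝ} (ht : t ∈ I) {j : ℕ} (hj : 2 ≤ j) (hjn : j + 2 ≤ n) :
    m j t ^ 2 * radiusSq (centreComponent v κ) j t ^ 2 =
      v t ^ 2 * κ (j + 1) t ^ 2 * radiusSq (centreComponent v κ) (j - 1) t *
        radiusSq (centreComponent v κ) (j + 1) t := by
  have hp := H.hasDerivAt_centreComponent hI (by omega : j + 2 ≤ n) ht
  have hY := H.hasDerivAt_sphereVec hI (by omega : 1 ≤ j) (by omega) ht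
  have hh := H.deriv_mid t ht (j + 2) (by omega) hjn
  -- The value of this derivative is irrelevant: it multiplies h_{j+2}, which is orthogonal to B_j.
  have hR : HasDerivAt (radiusSq (centreComponent v κ) j)
      (deriv (radiusSq (centreComponent v κ) j) t) t := by
    refine DifferentiableAt.hasDerivAt (DifferentiableAt.fun_sum fun b hb => ?_)
    rw [Finset.mem_Icc] at hb
    exact (H.hasDerivAt_centreComponent hI (by omega) ht).differentiableAt.fun_pow 2
  have hB : normalVec D h (centreComponent v κ) (j + 1) = fun t =>
      centreComponent v κ (j + 2) t • sphereVec D h (centreComponent v κ) j t -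
        radiusSq (centreComponent v κ) j t • h (j + 2) t := by
    ext1 t
    rw [normalVec, if_neg (by omega)]
    rfl
  have key := sq_mul_normalSq hI C H hc ht hj (by omega)
    (hB ▸ (hp.fun_smul hY).fun_sub (hR.fun_smul hh))
  have hval := fun c hc => H.normalVec_mid ht hj (by omega) (c := c) hc
  simp only [map_sub, map_add, map_smul, smul_eq_mul, H.normalVec_sphereVec ht hj le_rfl
    (by omega), hval (j + 1) (by omega), hval (j + 2) (by omega), hval (j + 2 + 1) (by omega),
    show j + 2 - 1 = j + 1 by omega] at key
  rw [normalSq, normalSq, if_neg (by omega), if_neg (by omega)] at key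
  simp only [H.centreSpeed_eq ht (by omega : 2 ≤ j + 1) (by omega), if_true, show j + 1 - 1 = j by
    omega, radiusSq_succ _ j, show j + 2 ≠ j + 1 by omega, show j + 2 + 1 ≠ j + 1 by omega,
    if_false, show j + 1 + 1 = j + 2 by omega] at key
  have r0 := (H.radiusSq_pos (by omega) ht (by omega : 1 ≤ j - 1)).ne'
  have r1 := (H.radiusSq_pos (by omega) ht (by omega : 1 ≤ j + 1)).ne'
  rw [radiusSq_succ _ j] at r1 ⊢
  refine mul_right_cancel₀ (mul_ne_zero r0 r1) ?_
  linear_combination key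

theorem curvature_sq_last (hn : 3 ≤ n) (hI : IsOpen I) (C : ConformalFrenetSystem I e w ψ m)
    (H : EuclideanFrenetSystem I D h N v κ) {c : ℝ → ℝ} (hc : ∀ t ∈ I, e 0 t = c t • D t)
    {t : ℝ} (ht : t ∈ I) :
    m (n - 1) t ^ 2 * radiusSq (centreComponent v κ) (n - 1) t ^ 2 =
      v t ^ 2 * centreSpeed v κ n t ^ 2 * radiusSq (centreComponent v κ) (n - 2) t := by
  obtain ⟨j, rfl⟩ : ∃ j, n = j + 1 := ⟨n - 1, by omega⟩
  have hY := H.hasDerivAt_sphereVec hI (by omega : 1 ≤ j) le_rfl ht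
  have hB : normalVec D h (centreComponent v κ) (j + 1) =
      sphereVec D h (centreComponent v κ) j := by
    ext1 t
    rw [normalVec, if_pos rfl]
    rfl
  have key := sq_mul_normalSq hI C H hc ht (by omega : 2 ≤ j) le_rfl (hB ▸ hY)
  -- The convention h_{n+1} = 0 removes the term with κ_n, which has no geometric meaning.
  rw [H.top t ht, smul_zero, add_zero, map_smul, map_smul, H.normalVec_mid ht (by omega)
    (by omega) (by omega), if_pos rfl, normalSq, normalSq, if_neg (by omega), if_pos rfl] at key
  simp only [Nat.add_sub_cancel, smul_eq_mul] at key
  have r0 := (H.radiusSq_pos (by omega) ht (by omega : 1 ≤ j - 1)).ne'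
  rw [show j + 1 - 1 = j by omega, show j + 1 - 2 = j - 1 by omega]
  refine mul_right_cancel₀ r0 ?_
  linear_combination key

/-- Compare the squared lengths of w e_1 = c' D + c v h_1, where D is null and orthogonal to h_1. -/
theorem speed_sq (hI : IsOpen I) (C : ConformalFrenetSystem I e w ψ m) (hn : 1 ≤ n)
    (H : EuclideanFrenetSystem I D h N v κ) {c : ℝ → ℝ} (hc : ∀ t ∈ I, e 0 t = c t • D t)
    {t : ℝ} (ht : t ∈ I) : w t ^ 2 = c t ^ 2 * v t ^ 2 := by
  -- The factor c is given only pointwise; pairing with N shows that it is differentiable.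
  have hcN : ∀ u ∈ I, c u = -lorentzForm n (e 0 u) N := by
    intro u hu
    rw [hc u hu, map_smul, LinearMap.smul_apply, H.point_infty u hu]
    simp
  have h0 := C.deriv_zero t ht
  have hcd := ((h0.lorentzForm (hasDerivAt_const t N)).fun_neg).congr_of_eventuallyEq
    (Filter.eventually_of_mem (hI.mem_nhds ht) hcN)
  have h1 := h0.unique ((hcd.fun_smul (H.deriv_point t ht)).congr_of_eventuallyEq
    (Filter.eventually_of_mem (hI.mem_nhds ht) hc))
  have h2 := congrArg (fun X => lorentzForm n X X) h1
  simp only [map_add, map_smul, LinearMap.add_apply, LinearMap.smul_apply, smul_eq_mul,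
    C.mid_mid t ht 1 1 le_rfl hn le_rfl hn, H.mid_mid t ht 1 1 le_rfl hn le_rfl,
    H.point_point t ht, H.point_mid t ht, lorentzForm_comm (h 1 t) (D t), if_true] at h2
  linear_combination h2

/-- The vector Z = κ_1 h_2 + N, up to the factor v the derivative of h_1, is orthogonal to e_2, …,
e_n. Differentiating ⟨Z, e_2⟩ = 0 gives ⟨Z', e_2⟩ = -w ⟨Z, e_0⟩ = w c, and w⁴ = v² (w c)². -/
theorem speed_pow_four (hn : 3 ≤ n) (hI : IsOpen I) (C : ConformalFrenetSystem I e w ψ m)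
    (H : EuclideanFrenetSystem I D h N v κ) {c : ℝ → ℝ} (hc : ∀ t ∈ I, e 0 t = c t • D t)
    {t : ℝ} (ht : t ∈ I) :
    w t ^ 4 = v t ^ 2 * (deriv (κ 1) t ^ 2 + v t ^ 2 * κ 1 t ^ 2 * κ 2 t ^ 2) := by
  have hk0 : ∀ u ∈ I, κ 1 u ≠ 0 := fun u hu => H.κ_ne u hu 1 le_rfl (by omega)
  have hp2 : ∀ u ∈ I, κ 1 u * centreComponent v κ 2 u = 1 := fun u hu =>
    mul_inv_cancel₀ (hk0 u hu)
  have hZh : ∀ u ∈ I, ∀ a, 3 ≤ a → lorentzForm n (κ 1 u • h 2 u + N) (h a u) = 0 := by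
    intro u hu a ha
    rw [map_add, map_smul, LinearMap.add_apply, LinearMap.smul_apply, H.infty_mid u hu,
      H.mid_mid u hu 2 a (by omega) (by omega) (by omega), if_neg (by omega), smul_zero, add_zero]
  have hNY : ∀ u ∈ I, ∀ i,
      lorentzForm n N (sphereVec D h (centreComponent v κ) i u) = -1 := by
    intro u hu i
    rw [sphereVec, map_add, lorentzForm_comm N, H.point_infty u hu, map_sum, Finset.sum_eq_zero,
      add_zero]
    intro a _
    rw [map_smul, H.infty_mid u hu, smul_zero]
  have hZY : ∀ u ∈ I, ∀ i, 1 ≤ i → i + 1 ≤ n → lorentzForm n (κ 1 u • h 2 u + N)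
      (sphereVec D h (centreComponent v κ) i u) = 0 := by
    intro u hu i hi hin
    rw [map_add, map_smul, LinearMap.add_apply, LinearMap.smul_apply, lorentzForm_comm (h 2 u),
      H.lorentzForm_sphereVec_mid hu hin (by omega), if_pos (by omega), hNY u hu i, smul_eq_mul,
      hp2 u hu, add_neg_cancel]
  have hZe : ∀ u ∈ I, ∀ a, 2 ≤ a → a ≤ n → lorentzForm n (κ 1 u • h 2 u + N) (e a u) = 0 := by
    intro u hu a ha han
    obtain ⟨β, hβ2, hβ⟩ := normalVec_eq_smul hI C H hc hu ha han
    have hβ0 : β ≠ 0 := by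
      rintro rfl
      have := H.normalSq_pos hu ha han
      rw [← hβ2] at this
      simp at this
    have h1 : lorentzForm n (κ 1 u • h 2 u + N) (normalVec D h (centreComponent v κ) a u) = 0 := by
      have h2 := hZY u hu (a - 1) (by omega) (by omega)
      rw [normalVec]
      split_ifs
      · exact h2
      · rw [map_sub, map_smul, map_smul, h2, hZh u hu (a + 1) (by omega), smul_zero, smul_zero,
          sub_zero]
    rw [hβ, map_smul, smul_eq_mul] at h1
    exact (mul_eq_zero.1 h1).resolve_left hβ0
  have hkd : HasDerivAt (κ 1) (deriv (κ 1) t) t :=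
    (((H.smooth_κ 1 le_rfl (by omega)).differentiableOn (by simp)).differentiableAt
      (hI.mem_nhds ht)).hasDerivAt
  have hZd := (hkd.fun_smul (H.deriv_mid t ht 2 le_rfl (by omega))).add_const N
  have h1 := lorentzForm_deriv_eq_neg hI ht (fun u hu => hZe u hu 2 le_rfl (by omega)) hZd
    (C.deriv_two t ht)
  obtain ⟨β, hβ2, hβ⟩ := normalVec_eq_smul hI C H hc ht le_rfl (by omega : 2 ≤ n)
  have hBh : ∀ a, 1 ≤ a → a ≤ 2 → lorentzForm n (normalVec D h (centreComponent v κ) 2 t) (h a t) =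
      centreComponent v κ 3 t * if a = 2 then centreComponent v κ 2 t else 0 := by
    intro a h1 h2
    rw [normalVec, if_neg (by omega)]
    simp only [map_sub, map_smul, LinearMap.sub_apply, LinearMap.smul_apply, smul_eq_mul]
    rw [H.lorentzForm_sphereVec_mid ht (by omega) h1, H.mid_mid t ht 3 a (by omega) hn h1,
      if_neg (by omega : ¬ 3 = a), mul_zero, sub_zero]
    obtain rfl | rfl : a = 1 ∨ a = 2 := by omega
    · simp
    · simp
  have h2 : lorentzForm n (normalVec D h (centreComponent v κ) 2 t)
      (κ 1 t • (v t • (-κ (2 - 1) t • h (2 - 1) t + κ 2 t • h (2 + 1) t)) +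
        deriv (κ 1) t • h 2 t) = β * (w t * c t) := by
    rw [hβ, map_smul, LinearMap.smul_apply, lorentzForm_comm, h1, map_add, map_smul, map_smul,
      hZe t ht 3 (by omega) hn, hc t ht, map_smul, map_add, map_smul, LinearMap.add_apply,
      LinearMap.smul_apply, lorentzForm_comm N, H.point_infty t ht, lorentzForm_comm (h 2 t),
      H.point_mid t ht]
    simp only [smul_eq_mul]
    ring
  simp only [map_add, map_smul, smul_eq_mul, hBh 2 (by omega) le_rfl, Nat.add_one_sub_one,
    hBh 1 le_rfl (by omega), H.normalVec_mid ht le_rfl (by omega) (by omega : 2 < 2 + 1)] at h2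
  have hw2 := speed_sq hI C (by omega) H hc ht
  have hv0 := (H.v_pos t ht).ne'
  have hk := hk0 t ht
  have hτ := H.κ_ne t ht 2 (by omega) hn
  have hp3 : centreComponent v κ 3 t = -deriv (κ 1) t / κ 1 t ^ 2 / v t / κ 2 t := by
    have h3 : centreComponent v κ 3 t = (deriv (centreComponent v κ 2) t / v t +
      κ 1 t * centreComponent v κ 1 t) / κ 2 t := rfl
    have h4 : deriv (centreComponent v κ 2) t = -deriv (κ 1) t / κ 1 t ^ 2 := (hkd.fun_inv hk).deriv
    have h5 : centreComponent v κ 1 t = 0 := rfl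
    rw [h3, h4, h5, mul_zero, add_zero]
  have hp2' : centreComponent v κ 2 t = (κ 1 t)⁻¹ := rfl
  have hR1 : radiusSq (centreComponent v κ) 1 t = (κ 1 t)⁻¹ ^ 2 := by
    simp [radiusSq, hp2']
  have hR2 := radiusSq_succ (centreComponent v κ) 1 t
  rw [normalSq, if_neg (by omega), show 2 - 1 = 1 from rfl] at hβ2
  rw [hR1] at hR2 hβ2
  simp only [Nat.reduceAdd] at hR2
  rw [hR2, hp3] at hβ2
  simp only [hR1, hp3, hp2', if_true, show ((1 : ℕ) = 2) = False by simp, if_false, mul_zero] at h2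
  -- Squaring removes the unknown sign of β. Both β² and ⟨B_2, Z'⟩ contain the factor k'² + v² κ_1²
  -- κ_2², and one copy cancels.
  have h6 : β ^ 2 * (w t ^ 2 * c t ^ 2) = (β * (w t * c t)) ^ 2 := by ring
  rw [← h2, hβ2] at h6
  set k' := deriv (κ 1) t
  have hQ : k' ^ 2 + v t ^ 2 * κ 1 t ^ 2 * κ 2 t ^ 2 ≠ 0 := by positivity
  have h7 : w t ^ 4 = v t ^ 2 * (w t ^ 2 * c t ^ 2) := by linear_combination w t ^ 2 * hw2
  rw [h7]
  congr 1
  field_simp at h6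
  refine mul_right_cancel₀ hQ ?_
  linear_combination h6

/-- Orthogonality to the last vectors of the conformal frame, in terms of the Euclidean frame. -/
theorem orthogonal_frame_iff (hI : IsOpen I) (C : ConformalFrenetSystem I e w ψ m)
    (H : EuclideanFrenetSystem I D h N v κ) {c : ℝ → ℝ} (hc : ∀ t ∈ I, e 0 t = c t • D t)
    {t : ℝ} (ht : t ∈ I) {i : ℕ} (hi : 1 ≤ i) (hin : i + 1 ≤ n) (X : Fin (n + 2) → ℝ) :
    (∀ a, i < a → a ≤ n → lorentzForm n X (e a t) = 0) ↔
      lorentzForm n X (sphereVec D h (centreComponent v κ) i t) = 0 ∧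
        ∀ a, i + 2 ≤ a → a ≤ n → lorentzForm n X (h a t) = 0 := by
  constructor
  · intro hX
    rw [← C.mem_span_flag_iff ht hi] at hX
    have key : ∀ Z, (∀ l ≤ i + 1, lorentzForm n (frenetFlag n e l t) Z = 0) →
        lorentzForm n X Z = 0 := by
      intro Z hZ
      induction hX using Submodule.span_induction with
      | mem X hX =>
        obtain ⟨l, hl, rfl⟩ := hX
        exact hZ l hl
      | zero => simp
      | add X Y _ _ hx hy => simp [hx, hy]
      | smul c X _ hx => simp [hx]
    exact ⟨key _ fun l hl =>
        (frenetFlag_orthogonal hI C H hc (by omega : l ≤ n) ht).2 i hi hl hin,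
      fun a h1 h2 => key _ fun l hl =>
        (frenetFlag_orthogonal hI C H hc (by omega : l ≤ n) ht).1 a (by omega) (by omega)⟩
  · rintro ⟨hY, hh⟩ a h1 h2
    -- For j ≥ i the difference Y_j - Y_i is a combination of h_{i+2}, …, h_{j+1}, so orthogonality
    -- passes to all later Y_j and hence to every B_a with a > i.
    have hY' : ∀ j, i ≤ j → j + 1 ≤ n →
        lorentzForm n X (sphereVec D h (centreComponent v κ) j t) = 0 := by
      intro j hj
      induction j, hj using Nat.le_induction with
      | base => exact fun _ => hY
      | succ j hj ih =>
        intro h3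
        rw [sphereVec_succ, map_add, ih (by omega), map_smul, hh (j + 2) (by omega) h3]
        simp
    obtain ⟨β, hβ2, hβ⟩ := normalVec_eq_smul hI C H hc ht (by omega : 2 ≤ a) h2
    have hβ0 : β ≠ 0 := by
      rintro rfl
      have := H.normalSq_pos ht (by omega : 2 ≤ a) h2
      rw [← hβ2] at this
      simp at this
    have h3 : lorentzForm n X (normalVec D h (centreComponent v κ) a t) = 0 := by
      have h4 := hY' (a - 1) (by omega) (by omega)
      rw [normalVec]
      split_ifs
      · exact h4
      · rw [map_sub, map_smul, map_smul, h4, hh (a + 1) (by omega) (by omega)]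
        simp
    rw [hβ, map_smul, smul_eq_mul] at h3
    exact (mul_eq_zero.1 h3).resolve_left hβ0

end Curvatures

/-! ### Lifting points and vectors of Euclidean space to the light cone. -/

section Lift

variable {n : ℕ}

/-- The lift of the vector `y` at the point `x` of `ℝⁿ`. -/
noncomputable def tangentVec (x y : EuclideanSpace ℝ (Fin n)) : Fin (n + 2) → ℝ :=
  Fin.cons (α := fun _ => ℝ) 0 (Fin.snoc (α := fun _ => ℝ) (fun i => y i) (inner ℝ x y))

/-- The homogeneous coordinates of the point at infinity. -/
def inftyVec (n : ℕ) : Fin (n + 2) → ℝ := Pi.single (Fin.last (n + 1)) 1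

/-- The components `1, …, n` of a vector of `ℝ^{n+2}`. -/
noncomputable def midPart (n : ℕ) : (Fin (n + 2) → ℝ) →L[ℝ] EuclideanSpace ℝ (Fin n) :=
  LinearMap.toContinuousLinearMap
    { toFun := fun X => WithLp.toLp 2 fun i => X i.castSucc.succ
      map_add' := fun _ _ => rfl
      map_smul' := fun _ _ => rfl }

theorem midPart_apply (X : Fin (n + 2) → ℝ) (i : Fin n) : midPart n X i = X i.castSucc.succ := rfl

theorem fin_add_two_ext {X Y : Fin (n + 2) → ℝ} (h0 : X 0 = Y 0)
    (h1 : X (Fin.last _) = Y (Fin.last _)) (h : ∀ i : Fin n, X i.castSucc.succ = Y i.castSucc.succ) :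
    X = Y := by
  ext i
  refine Fin.cases h0 (fun i => ?_) i
  refine Fin.lastCases ?_ h i
  rwa [Fin.succ_last]

theorem hasDerivAt_fin_add_two {X : ℝ → Fin (n + 2) → ℝ} {X' : Fin (n + 2) → ℝ} {t : ℝ}
    (h0 : HasDerivAt (fun u => X u 0) (X' 0) t)
    (h1 : HasDerivAt (fun u => X u (Fin.last _)) (X' (Fin.last _)) t)
    (h : ∀ i : Fin n, HasDerivAt (fun u => X u i.castSucc.succ) (X' i.castSucc.succ) t) :
    HasDerivAt X X' t := by
  rw [hasDerivAt_pi]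
  intro i
  refine Fin.cases h0 (fun i => ?_) i
  refine Fin.lastCases ?_ h i
  rwa [Fin.succ_last]

section Components

variable (x y : EuclideanSpace ℝ (Fin n)) (i : Fin n)

theorem diracWeylVec_zero : diracWeylVec x 0 = 1 := rfl

theorem diracWeylVec_last : diracWeylVec x (Fin.last (n + 1)) = ‖x‖ ^ 2 / 2 := by
  rw [← Fin.succ_last]; simp [diracWeylVec]

theorem diracWeylVec_mid : diracWeylVec x i.castSucc.succ = x i := by
  simp [diracWeylVec]

theorem tangentVec_zero : tangentVec x y 0 = 0 := rfl

theorem tangentVec_last : tangentVec x y (Fin.last (n + 1)) = inner ℝ x y := by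
  rw [← Fin.succ_last]; simp [tangentVec]

theorem tangentVec_mid : tangentVec x y i.castSucc.succ = y i := by
  simp [tangentVec]

theorem inftyVec_zero : inftyVec n 0 = 0 := by
  rw [inftyVec, Pi.single_eq_of_ne (Fin.last_pos).ne]

theorem inftyVec_last : inftyVec n (Fin.last (n + 1)) = 1 := by
  rw [inftyVec, Pi.single_eq_same]

theorem inftyVec_mid : inftyVec n i.castSucc.succ = 0 := by
  rw [inftyVec, Pi.single_eq_of_ne]
  rw [Fin.succ_castSucc]
  exact (Fin.castSucc_lt_last _).ne

end Components

theorem sum_mul_eq_inner (x y : EuclideanSpace ℝ (Fin n)) : ∑ i, x i * y i = inner ℝ x y := by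
  rw [PiLp.inner_apply]
  exact Finset.sum_congr rfl fun i _ => by simp [mul_comm]

theorem lorentzForm_dirac_dirac (x y : EuclideanSpace ℝ (Fin n)) :
    lorentzForm n (diracWeylVec x) (diracWeylVec y) = -‖x - y‖ ^ 2 / 2 := by
  rw [lorentzForm_apply]
  simp only [diracWeylVec_zero, diracWeylVec_last, diracWeylVec_mid]
  rw [sum_mul_eq_inner, norm_sub_sq_real]
  ring

theorem lorentzForm_dirac_tangent (z x y : EuclideanSpace ℝ (Fin n)) :
    lorentzForm n (diracWeylVec z) (tangentVec x y) = inner ℝ (z - x) y := by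
  rw [lorentzForm_apply]
  simp only [diracWeylVec_zero, diracWeylVec_last, diracWeylVec_mid, tangentVec_zero,
    tangentVec_last, tangentVec_mid]
  rw [sum_mul_eq_inner, inner_sub_left]
  ring

theorem lorentzForm_dirac_infty (z : EuclideanSpace ℝ (Fin n)) :
    lorentzForm n (diracWeylVec z) (inftyVec n) = -1 := by
  rw [lorentzForm_apply]
  simp [diracWeylVec_zero, inftyVec_zero, inftyVec_last, inftyVec_mid]

theorem lorentzForm_tangent_tangent (x y z : EuclideanSpace ℝ (Fin n)) :
    lorentzForm n (tangentVec x y) (tangentVec x z) = inner ℝ y z := by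
  rw [lorentzForm_apply]
  simp only [tangentVec_zero, tangentVec_last, tangentVec_mid]
  rw [sum_mul_eq_inner]
  ring

theorem lorentzForm_infty_tangent (x y : EuclideanSpace ℝ (Fin n)) :
    lorentzForm n (inftyVec n) (tangentVec x y) = 0 := by
  rw [lorentzForm_apply]
  simp [tangentVec_zero, inftyVec_zero, inftyVec_mid]

theorem lorentzForm_infty_infty : lorentzForm n (inftyVec n) (inftyVec n) = 0 := by
  rw [lorentzForm_apply]
  simp [inftyVec_zero, inftyVec_mid]

theorem tangentVec_add (x y z : EuclideanSpace ℝ (Fin n)) :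
    tangentVec x (y + z) = tangentVec x y + tangentVec x z := by
  apply fin_add_two_ext
  · simp [tangentVec_zero]
  · simp [tangentVec_last, inner_add_right]
  · simp [tangentVec_mid]

theorem tangentVec_smul (x : EuclideanSpace ℝ (Fin n)) (c : ℝ) (y : EuclideanSpace ℝ (Fin n)) :
    tangentVec x (c • y) = c • tangentVec x y := by
  apply fin_add_two_ext
  · simp [tangentVec_zero]
  · simp [tangentVec_last, inner_smul_right]
  · simp [tangentVec_mid]

theorem midPart_dirac (x : EuclideanSpace ℝ (Fin n)) : midPart n (diracWeylVec x) = x := by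
  ext i; rw [midPart_apply, diracWeylVec_mid]

theorem midPart_tangent (x y : EuclideanSpace ℝ (Fin n)) : midPart n (tangentVec x y) = y := by
  ext i; rw [midPart_apply, tangentVec_mid]

theorem HasDerivAt.diracWeylVec {F : ℝ → EuclideanSpace ℝ (Fin n)}
    {F' : EuclideanSpace ℝ (Fin n)} {t : ℝ} (hF : HasDerivAt F F' t) :
    HasDerivAt (fun u => diracWeylVec (F u)) (tangentVec (F t) F') t := by
  apply hasDerivAt_fin_add_two
  · simp only [diracWeylVec_zero, tangentVec_zero]
    exact hasDerivAt_const t 1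
  · simp only [diracWeylVec_last, tangentVec_last]
    exact (hF.norm_sq.div_const 2).congr_deriv (by ring)
  · intro i
    simp only [diracWeylVec_mid, tangentVec_mid]
    exact (EuclideanSpace.proj (𝕜 := ℝ) i).hasFDerivAt.comp_hasDerivAt t hF

/-- The term at infinity comes from moving the base point in the last coordinate ⟨F, G⟩. -/
theorem hasDerivAt_tangentVec {F G : ℝ → EuclideanSpace ℝ (Fin n)}
    {F' G' : EuclideanSpace ℝ (Fin n)} {t : ℝ} (hF : HasDerivAt F F' t) (hG : HasDerivAt G G' t) :
    HasDerivAt (fun u => tangentVec (F u) (G u))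
      (tangentVec (F t) G' + inner ℝ F' (G t) • inftyVec n) t := by
  apply hasDerivAt_fin_add_two
  · simp only [Pi.add_apply, Pi.smul_apply, tangentVec_zero, inftyVec_zero, smul_zero, add_zero]
    exact hasDerivAt_const t 0
  · simp only [Pi.add_apply, Pi.smul_apply, tangentVec_last, inftyVec_last, smul_eq_mul, mul_one]
    exact hF.inner ℝ hG
  · intro i
    simp only [Pi.add_apply, Pi.smul_apply, tangentVec_mid, inftyVec_mid, smul_zero, add_zero]
    exact (EuclideanSpace.proj (𝕜 := ℝ) i).hasFDerivAt.comp_hasDerivAt t hG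

theorem ContDiffOn.diracWeylVec {I : Set ℝ} {F : ℝ → EuclideanSpace ℝ (Fin n)}
    (hF : ContDiffOn ℝ ∞ F I) : ContDiffOn ℝ ∞ (fun u => diracWeylVec (F u)) I := by
  rw [contDiffOn_pi]
  intro i
  refine Fin.cases contDiffOn_const (fun i => ?_) i
  refine Fin.lastCases ?_ (fun i => ?_) i
  · rw [Fin.succ_last]
    simp only [diracWeylVec_last]
    exact (hF.norm_sq ℝ).div_const 2
  · simp only [diracWeylVec_mid]
    exact (EuclideanSpace.proj (𝕜 := ℝ) i).contDiff.comp_contDiffOn hF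

end Lift

/-! ### The lifted Euclidean Frenet equations. -/

section EuclideanFrame

variable {n : ℕ} {I : Set ℝ} {F : ℝ → EuclideanSpace ℝ (Fin n)}
  {E : ℕ → ℝ → EuclideanSpace ℝ (Fin n)} {k : ℝ → ℝ} {τ : ℕ → ℝ → ℝ}

/-- The lift of a Euclidean Frenet frame, with `h_{n+1} = 0`. -/
noncomputable def liftFrame (F : ℝ → EuclideanSpace ℝ (Fin n)) (E : ℕ → ℝ → EuclideanSpace ℝ (Fin n)) (a : ℕ)
    (t : ℝ) : Fin (n + 2) → ℝ :=
  if a ≤ n then tangentVec (F t) (E a t) else 0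

/-- The curvatures `κ_1 = k`, `κ_a = τ_a`. -/
def curvatures (k : ℝ → ℝ) (τ : ℕ → ℝ → ℝ) (a : ℕ) : ℝ → ℝ := if a = 1 then k else τ a

theorem IsEuclideanFrenetFrame.system (hn : 3 ≤ n) (hI : IsOpen I)
    (hE : IsEuclideanFrenetFrame I F E k τ) :
    EuclideanFrenetSystem I (fun t => diracWeylVec (F t)) (liftFrame F E) (inftyVec n)
      (fun t => ‖deriv F t‖) (curvatures k τ) := by
  have hF' : ContDiffOn ℝ ∞ (deriv F) I :=
    ((contDiffOn_infty_iff_deriv_of_isOpen hI).1 hE.smooth_curve).2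
  have hv : ContDiffOn ℝ ∞ (fun t => ‖deriv F t‖) I := hF'.norm ℝ hE.immersed
  have hv0 : ∀ t ∈ I, 0 < ‖deriv F t‖ := fun t ht => norm_pos_iff.2 (hE.immersed t ht)
  have hFd : ∀ t ∈ I, HasDerivAt F (deriv F t) t := fun t ht =>
    ((hE.smooth_curve.differentiableOn (by simp)).differentiableAt (hI.mem_nhds ht)).hasDerivAt
  have hEd : ∀ t ∈ I, ∀ a, 1 ≤ a → a ≤ n → HasDerivAt (E a) (deriv (E a) t) t :=
    fun t ht a h1 h2 => (((hE.smooth_frame a h1 h2).differentiableOn (by simp)).differentiableAt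
      (hI.mem_nhds ht)).hasDerivAt
  have hderiv : ∀ t ∈ I, ∀ a, 2 ≤ a → a + 1 ≤ n → deriv (E a) t = ‖deriv F t‖ •
      (-curvatures k τ (a - 1) t • E (a - 1) t + curvatures k τ a t • E (a + 1) t) := by
    intro t ht a h1 h2
    rcases h1.eq_or_lt with rfl | h3
    · exact hE.deriv_two t ht
    · rw [hE.deriv_mid t ht a h3 h2, curvatures, curvatures, if_neg (by omega), if_neg (by omega)]
  -- Smoothness of the curvatures is not assumed; it follows from this expression in the smooth
  -- frame.
  have hκ : ∀ a, 1 ≤ a → a + 1 ≤ n → ∀ t ∈ I, curvatures k τ a t =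
      inner ℝ (deriv (E a) t) (E (a + 1) t) / ‖deriv F t‖ := by
    intro a h1 h2 t ht
    have := (hv0 t ht).ne'
    rw [eq_div_iff this]
    rcases h1.eq_or_lt with rfl | h3
    · rw [hE.deriv_one t ht, inner_smul_left, inner_smul_left,
        hE.orthonormal t ht _ _ (by omega) h2 (by omega) h2, if_pos rfl]
      simp [curvatures, mul_comm]
    · rw [hderiv t ht a h3 h2, inner_smul_left, inner_add_left, inner_smul_left, inner_smul_left,
        hE.orthonormal t ht _ _ (by omega) (by omega) (by omega) h2,
        hE.orthonormal t ht _ _ (by omega) (by omega) (by omega) h2, if_neg (by omega), if_pos rfl]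
      simp [mul_comm]
  have hlift : ∀ a, a ≤ n → liftFrame F E a = fun t => tangentVec (F t) (E a t) := by
    intro a ha
    ext1 t
    rw [liftFrame, if_pos ha]
  -- F' is a multiple of E_1, so the point at infinity enters only the derivative of h_1.
  have hTd : ∀ t ∈ I, ∀ a, 1 ≤ a → a ≤ n → HasDerivAt (liftFrame F E a)
      (tangentVec (F t) (deriv (E a) t) + (if a = 1 then ‖deriv F t‖ else 0) • inftyVec n) t := by
    intro t ht a h1 h2
    rw [hlift a h2]
    refine (hasDerivAt_tangentVec (hFd t ht) (hEd t ht a h1 h2)).congr_deriv ?_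
    conv_lhs => rw [hE.deriv_curve t ht, inner_smul_left,
      hE.orthonormal t ht _ _ le_rfl (by omega) h1 h2]
    congr 2
    simp [eq_comm]
  refine
    { smooth_v := hv
      smooth_κ := fun a h1 h2 => ContDiffOn.congr
        ((((contDiffOn_infty_iff_deriv_of_isOpen hI).1 (hE.smooth_frame a h1 (by omega))).2.inner ℝ
          (hE.smooth_frame (a + 1) (by omega) h2)).div hv fun t ht => (hv0 t ht).ne') (hκ a h1 h2)
      v_pos := hv0
      κ_ne := ?_
      point_point := fun t _ => lorentzForm_diracWeylVec _
      infty_infty := lorentzForm_infty_infty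
      point_infty := fun t _ => lorentzForm_dirac_infty _
      point_mid := ?_
      infty_mid := ?_
      mid_mid := ?_
      top := fun t _ => if_neg (by omega)
      deriv_point := ?_
      deriv_one := ?_
      deriv_mid := ?_ }
  · intro t ht a h1 h2
    rw [curvatures]
    split_ifs with h3
    · exact (hE.curvature_pos t ht).ne'
    · rcases Nat.lt_or_ge n (a + 2) with h4 | h4
      · obtain rfl : a = n - 1 := by omega
        exact hE.torsion_last t ht
      · exact (hE.torsion_pos t ht a (by omega) h4).ne'
  · intro t _ a
    rw [liftFrame]
    split_ifs
    · rw [lorentzForm_dirac_tangent, sub_self, inner_zero_left]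
    · exact map_zero _
  · intro t _ a
    rw [liftFrame]
    split_ifs
    · exact lorentzForm_infty_tangent _ _
    · exact map_zero _
  · intro t ht a b h1 h2 h3
    rw [liftFrame, if_pos h2, liftFrame]
    split_ifs with h4 h5 h5
    · rw [lorentzForm_tangent_tangent, hE.orthonormal t ht a b h1 h2 h3 h4, if_pos h5]
    · rw [lorentzForm_tangent_tangent, hE.orthonormal t ht a b h1 h2 h3 h4, if_neg h5]
    · omega
    · exact map_zero _
  · intro t ht
    refine (hFd t ht).diracWeylVec.congr_deriv ?_
    rw [liftFrame, if_pos (by omega), ← tangentVec_smul, ← hE.deriv_curve t ht]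
  · intro t ht
    refine (hTd t ht 1 le_rfl (by omega)).congr_deriv ?_
    rw [hE.deriv_one t ht, tangentVec_smul, tangentVec_smul, if_pos rfl, smul_add, liftFrame,
      if_pos (by omega)]
    rfl
  · intro t ht a h1 h2
    refine (hTd t ht a (by omega) h2).congr_deriv ?_
    rw [if_neg (by omega), zero_smul, add_zero]
    rcases h2.eq_or_lt with rfl | h3
    · rw [hE.deriv_last t ht, tangentVec_smul, tangentVec_smul, liftFrame, if_pos (by omega),
        liftFrame, if_neg (by omega), smul_zero, add_zero, curvatures, if_neg (by omega)]
    · rw [hderiv t ht a h1 h3, tangentVec_smul, tangentVec_add, tangentVec_smul, tangentVec_smul,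
        liftFrame, if_pos (by omega), liftFrame, if_pos (by omega)]

end EuclideanFrame

/-! ### Centres and radii of the osculating spheres. -/

section OsculatingSphere

variable {n : ℕ} {I : Set ℝ} {F : ℝ → EuclideanSpace ℝ (Fin n)}
  {E : ℕ → ℝ → EuclideanSpace ℝ (Fin n)} {k : ℝ → ℝ} {τ : ℕ → ℝ → ℝ}

/-- The centre of the osculating `i`-sphere of a curve with Frenet frame `E`. -/
noncomputable def sphereCentre (F : ℝ → EuclideanSpace ℝ (Fin n))
    (E : ℕ → ℝ → EuclideanSpace ℝ (Fin n)) (p : ℕ → ℝ → ℝ) (i : ℕ) (t : ℝ) :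
    EuclideanSpace ℝ (Fin n) :=
  F t + ∑ a ∈ Finset.Icc 2 (i + 1), p a t • E a t

theorem norm_sq_sum_frame (hE : IsEuclideanFrenetFrame I F E k τ) {t : ℝ} (ht : t ∈ I)
    (p : ℕ → ℝ → ℝ) {i : ℕ} (hi : i + 1 ≤ n) :
    ‖∑ a ∈ Finset.Icc 2 (i + 1), p a t • E a t‖ ^ 2 = radiusSq p i t := by
  rw [← real_inner_self_eq_norm_sq, sum_inner, radiusSq]
  refine Finset.sum_congr rfl fun a ha => ?_
  rw [inner_sum, Finset.sum_congr rfl (g := fun b => if a = b then p a t ^ 2 else 0)]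
  · rw [Finset.sum_ite_eq, if_pos ha]
  · intro b hb
    rw [Finset.mem_Icc] at ha hb
    rw [inner_smul_left, inner_smul_right,
      hE.orthonormal t ht a b (by omega) (by omega) (by omega) (by omega)]
    split_ifs with h
    · subst h; simp [pow_two]
    · simp

/-- Complete the square in -|x - F|²/2 + ⟨x - F, Σ p_a E_a⟩. -/
theorem lorentzForm_dirac_sphereVec (hE : IsEuclideanFrenetFrame I F E k τ) {t : ℝ} (ht : t ∈ I)
    (p : ℕ → ℝ → ℝ) {i : ℕ} (hi : i + 1 ≤ n) (x : EuclideanSpace ℝ (Fin n)) :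
    lorentzForm n (diracWeylVec x)
      (sphereVec (fun t => diracWeylVec (F t)) (liftFrame F E) p i t) =
      (radiusSq p i t - dist x (sphereCentre F E p i t) ^ 2) / 2 := by
  have h1 : lorentzForm n (diracWeylVec x)
      (∑ a ∈ Finset.Icc 2 (i + 1), p a t • liftFrame F E a t) =
      inner ℝ (x - F t) (∑ a ∈ Finset.Icc 2 (i + 1), p a t • E a t) := by
    rw [map_sum, inner_sum]
    refine Finset.sum_congr rfl fun a ha => ?_
    rw [Finset.mem_Icc] at ha
    rw [map_smul, liftFrame, if_pos (by omega), lorentzForm_dirac_tangent, inner_smul_right,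
      smul_eq_mul]
  rw [sphereVec, map_add, h1, lorentzForm_dirac_dirac, ← norm_sq_sum_frame hE ht p hi,
    sphereCentre, dist_eq_norm, ← sub_sub, norm_sub_sq_real (x - F t)]
  ring

theorem midPart_sphereVec (p : ℕ → ℝ → ℝ) {i : ℕ} (hi : i + 1 ≤ n) (t : ℝ) :
    midPart n (sphereVec (fun t => diracWeylVec (F t)) (liftFrame F E) p i t) =
      sphereCentre F E p i t := by
  rw [sphereVec, map_add, map_sum, midPart_dirac, sphereCentre]
  congr 1
  refine Finset.sum_congr rfl fun a ha => ?_
  rw [Finset.mem_Icc] at ha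
  rw [map_smul, liftFrame, if_pos (by omega), midPart_tangent]

/-- The affine span of the osculating `i`-sphere. -/
noncomputable def osculatingAffine (F : ℝ → EuclideanSpace ℝ (Fin n))
    (E : ℕ → ℝ → EuclideanSpace ℝ (Fin n)) (i : ℕ) (t : ℝ) :
    AffineSubspace ℝ (EuclideanSpace ℝ (Fin n)) :=
  AffineSubspace.mk' (F t)
    (Submodule.span ℝ (Set.range fun a : Fin (n - i - 1) => E (i + 2 + a) t))ᗮ

theorem mem_osculatingAffine (i : ℕ) (t : ℝ) (x : EuclideanSpace ℝ (Fin n)) :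
    x ∈ osculatingAffine F E i t ↔ ∀ a, i + 2 ≤ a → a ≤ n → inner ℝ (x - F t) (E a t) = 0 := by
  rw [osculatingAffine, AffineSubspace.mem_mk', vsub_eq_sub, Submodule.mem_orthogonal']
  constructor
  · intro h a h1 h2
    refine h _ (Submodule.subset_span ⟨⟨a - (i + 2), by omega⟩, ?_⟩)
    simp only [Nat.add_sub_cancel' h1]
  · intro h y hy
    induction hy using Submodule.span_induction with
    | mem y hy =>
      obtain ⟨a, rfl⟩ := hy
      exact h _ (by omega) (by omega)
    | zero => exact inner_zero_right _
    | add y z _ _ h1 h2 => rw [inner_add_right, h1, h2, add_zero]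
    | smul c y _ h1 => rw [inner_smul_right, h1, mul_zero]

theorem finrank_osculatingAffine (hE : IsEuclideanFrenetFrame I F E k τ) {t : ℝ} (ht : t ∈ I)
    {i : ℕ} (hi : i + 1 ≤ n) : Module.finrank ℝ (osculatingAffine F E i t).direction = i + 1 := by
  have ho : Orthonormal ℝ fun a : Fin (n - i - 1) => E (i + 2 + a) t := by
    rw [orthonormal_iff_ite]
    intro a b
    rw [hE.orthonormal t ht _ _ (by omega) (by omega) (by omega) (by omega)]
    simp [Fin.ext_iff]
  have h1 := finrank_span_eq_card ho.linearIndependent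
  have h2 := Submodule.finrank_add_finrank_orthogonal
    (Submodule.span ℝ (Set.range fun a : Fin (n - i - 1) => E (i + 2 + a) t))
  rw [h1, Fintype.card_fin, finrank_euclideanSpace_fin] at h2
  rw [osculatingAffine, AffineSubspace.direction_mk']
  omega

/-- Orthogonality to h_{i+2}, …, h_n cuts out the affine subspace through F spanned by E_1, …,
E_{i+1}, and orthogonality to Y_i cuts out the hypersphere. -/
theorem isRoundSphere_osculatingSphere (hn : 3 ≤ n) (hI : IsOpen I)
    {e : ℕ → ℝ → Fin (n + 2) → ℝ} {w ψ : ℝ → ℝ} {m : ℕ → ℝ → ℝ}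
    (C : ConformalFrenetSystem I e w ψ m) (hE : IsEuclideanFrenetFrame I F E k τ)
    {c : ℝ → ℝ} (hc : ∀ t ∈ I, e 0 t = c t • diracWeylVec (F t))
    (hspan : ∀ t ∈ I, Submodule.span ℝ {diracWeylVec (F t)} = Submodule.span ℝ {e 0 t})
    {i : ℕ} (hi : 1 ≤ i) (hin : i + 1 ≤ n) {t : ℝ} (ht : t ∈ I) :
    IsRoundSphere i (osculatingSphere F i t)
      (sphereCentre F E (centreComponent (fun t => ‖deriv F t‖) (curvatures k τ)) i t)
      √(radiusSq (centreComponent (fun t => ‖deriv F t‖) (curvatures k τ)) i t) := by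
  have H := hE.system hn hI
  set p := centreComponent (fun t => ‖deriv F t‖) (curvatures k τ) with hp
  have hR := H.radiusSq_pos (by omega) ht hi
  refine ⟨Real.sqrt_pos.2 hR, osculatingAffine F E i t, finrank_osculatingAffine hE ht hin, ?_, ?_⟩
  · rw [mem_osculatingAffine]
    intro a h1 h2
    rw [sphereCentre, add_sub_cancel_left, sum_inner]
    refine Finset.sum_eq_zero fun b hb => ?_
    rw [Finset.mem_Icc] at hb
    rw [inner_smul_left, hE.orthonormal t ht b a (by omega) (by omega) (by omega) h2,
      if_neg (by omega), mul_zero]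
  · ext x
    rw [osculatingSphere, Set.mem_ofPred_eq, C.mem_osculatingSpace_iff hI
      hE.smooth_curve.diracWeylVec hspan hi hin ht, orthogonal_frame_iff hI C H hc ht hi hin,
      lorentzForm_dirac_sphereVec hE ht _ hin, Set.mem_ofPred_eq, mem_osculatingAffine, and_comm]
    refine and_congr ?_ ?_
    · refine forall_congr' fun a => forall_congr' fun h1 => forall_congr' fun h2 => ?_
      rw [liftFrame, if_pos h2, lorentzForm_dirac_tangent]
    · rw [← hp, div_eq_zero_iff, sub_eq_zero, or_iff_left two_ne_zero]
      constructor
      · intro h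
        rw [h, Real.sqrt_sq dist_nonneg]
      · intro h
        rw [h, Real.sq_sqrt hR.le]

theorem contDiffOn_sphereCentre (hn : 3 ≤ n) (hI : IsOpen I)
    (hE : IsEuclideanFrenetFrame I F E k τ) {i : ℕ} (hi : i + 1 ≤ n) :
    ContDiffOn ℝ ∞ (sphereCentre F E
      (centreComponent (fun t => ‖deriv F t‖) (curvatures k τ)) i) I := by
  refine hE.smooth_curve.add (ContDiffOn.sum fun a ha => ?_)
  rw [Finset.mem_Icc] at ha
  exact ((hE.system hn hI).contDiffOn_centreComponent hI a (by omega)).smul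
    (hE.smooth_frame a (by omega) (by omega))

/-- The centre is the middle part of Y_{n-1}, whose derivative is a multiple of h_n alone; the
middle part of h_n is the unit vector E_n. -/
theorem norm_deriv_sphereCentre (hn : 3 ≤ n) (hI : IsOpen I)
    (hE : IsEuclideanFrenetFrame I F E k τ) {t : ℝ} (ht : t ∈ I) :
    ‖deriv (sphereCentre F E
      (centreComponent (fun t => ‖deriv F t‖) (curvatures k τ)) (n - 1)) t‖ =
      ‖deriv F t‖ * |centreSpeed (fun t => ‖deriv F t‖) (curvatures k τ) n t| := by
  have H := hE.system hn hI
  have h1 := H.hasDerivAt_sphereVec hI (by omega : 1 ≤ n - 1) (by omega) ht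
  rw [show n - 1 + 2 = n + 1 by omega, H.top t ht, smul_zero, add_zero,
    Nat.sub_add_cancel (by omega)] at h1
  have h2 := (midPart n).hasFDerivAt.comp_hasDerivAt t h1
  have h3 : (midPart n ∘ sphereVec (fun t => diracWeylVec (F t)) (liftFrame F E)
      (centreComponent (fun t => ‖deriv F t‖) (curvatures k τ)) (n - 1)) = sphereCentre F E
      (centreComponent (fun t => ‖deriv F t‖) (curvatures k τ)) (n - 1) := by
    ext1 u
    exact midPart_sphereVec _ (by omega) u
  rw [h3] at h2
  have h4 : ‖E n t‖ = 1 := by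
    have h5 := hE.orthonormal t ht n n (by omega) le_rfl (by omega) le_rfl
    rw [if_pos rfl, real_inner_self_eq_norm_sq] at h5
    exact (pow_eq_one_iff_of_nonneg (norm_nonneg _) two_ne_zero).1 h5
  rw [h2.deriv, map_smul, map_smul, liftFrame, if_pos le_rfl, midPart_tangent, norm_smul,
    norm_smul, h4, norm_norm, Real.norm_eq_abs, mul_one]

/-- Both sides are positive, so fourth powers can be compared; pulling out v⁴ turns the parameter
derivative of k into its arclength derivative. -/
theorem speed_eq_arclengthRatio (hn : 3 ≤ n) (hI : IsOpen I)
    {e : ℕ → ℝ → Fin (n + 2) → ℝ} {w ψ : ℝ → ℝ} {m : ℕ → ℝ → ℝ}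
    (C : ConformalFrenetSystem I e w ψ m) (hE : IsEuclideanFrenetFrame I F E k τ)
    {c : ℝ → ℝ} (hc : ∀ t ∈ I, e 0 t = c t • diracWeylVec (F t)) {t : ℝ} (ht : t ∈ I) :
    0 < arclengthRatio F k τ t ∧ w t = ‖deriv F t‖ * arclengthRatio F k τ t := by
  have H := hE.system hn hI
  have h1 := speed_pow_four hn hI C H hc ht
  have hv := H.v_pos t ht
  have hk1 : curvatures k τ 1 = k := if_pos rfl
  have hk2 : curvatures k τ 2 = τ 2 := if_neg (by omega)
  have hk := H.κ_ne t ht 1 le_rfl (by omega)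
  have hτ := H.κ_ne t ht 2 (by omega) hn
  simp only [hk1, hk2] at h1 hk hτ
  have hQ : 0 < (deriv k t / ‖deriv F t‖) ^ 2 + k t ^ 2 * τ 2 t ^ 2 := by positivity
  have hpos : 0 < arclengthRatio F k τ t := Real.rpow_pos_of_pos hQ _
  refine ⟨hpos, ?_⟩
  have h4 : arclengthRatio F k τ t ^ 4 =
      (deriv k t / ‖deriv F t‖) ^ 2 + k t ^ 2 * τ 2 t ^ 2 := by
    rw [arclengthRatio, ← Real.rpow_natCast, ← Real.rpow_mul hQ.le]
    norm_num
  refine (pow_left_inj₀ (C.w_pos t ht).le (by positivity) (by norm_num : 4 ≠ 0)).1 ?_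
  rw [mul_pow, h4, h1]
  field_simp

end OsculatingSphere

/-! ### The theorem. -/

theorem mainTheorem7 (n : ℕ) (hn : 3 ≤ n) (I : Set ℝ) (hI : IsOpen I) (hI' : I.OrdConnected)
    (f : ℝ → ConformalSphere n) (e : ℝ → Matrix (Fin (n + 2)) (Fin (n + 2)) ℝ)
    (he : IsConformalFrenetFrame I f e) (s : ℝ → ℝ) (hs : IsConformalArclength I e s) :
    (∀ η : ℝ → Fin (n + 2) → ℝ, IsSmoothLift I f η →
      ∀ j, 2 ≤ j → j ≤ n - 1 → ∀ t ∈ I,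
        ContDiffAt ℝ 2 (osculatingTrace I η s j t) 0 ∧
        iteratedDeriv 2 (osculatingTrace I η s j t) 0 ≤ 0 ∧
        traceCurvature I η s j t = |conformalCurvature e j t| ∧
        (j ≤ n - 2 → traceCurvature I η s j t = conformalCurvature e j t)) ∧
    (∀ (F : ℝ → EuclideanSpace ℝ (Fin n)) (E : ℕ → ℝ → EuclideanSpace ℝ (Fin n))
        (k : ℝ → ℝ) (τ : ℕ → ℝ → ℝ),
      (∀ t ∈ I, f t = diracWeyl (F t)) → IsEuclideanFrenetFrame I F E k τ →
      ∃ (c : ℕ → ℝ → EuclideanSpace ℝ (Fin n)) (r : ℕ → ℝ → ℝ),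
        (∀ i, 1 ≤ i → i ≤ n - 1 → ∀ t ∈ I,
          IsRoundSphere i (osculatingSphere F i t) (c i t) (r i t)) ∧
        (∀ j, 2 ≤ j → j ≤ n - 2 → ∀ t ∈ I,
          conformalCurvature e j t =
            r (j - 1) t * r (j + 1) t * |τ (j + 1) t| /
              (r j t ^ 2 * arclengthRatio F k τ t)) ∧
        ContDiffOn ℝ ∞ (c (n - 1)) I ∧
        (∀ t ∈ I,
          |conformalCurvature e (n - 1) t| =
            r (n - 2) t * (‖deriv (c (n - 1)) t‖ / ‖deriv F t‖) /
              (r (n - 1) t ^ 2 * arclengthRatio F k τ t))) := by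
  have C := he.system hn hI
  constructor
  · intro η hη j hj hjn t ht
    have hspan : ∀ t ∈ I, Submodule.span ℝ {η t} = Submodule.span ℝ {frameVec e 0 t} :=
      fun t ht => (hη.2 t ht).symm.trans (he.along t ht)
    obtain ⟨h1, h2⟩ := C.osculatingTrace_deriv hI hI' hs hη.1 hspan hj (by omega) ht
    have h3 : traceCurvature I η s j t = |conformalCurvature e j t| := by
      rw [traceCurvature, h2, ← Real.sqrt_sq_eq_abs]
      congr 1
      rw [conformalCurvature]
      ring
    refine ⟨h1, ?_, h3, fun h4 => ?_⟩
    · rw [h2]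
      nlinarith [sq_nonneg (frameForm e (j + 1) j t / frameForm e 1 0 t)]
    · rw [h3, abs_of_pos]
      exact div_pos (he.generic t ht j hj (by omega)) (he.immersed t ht)
  · intro F E k τ hF hE
    have H := hE.system hn hI
    have hspan : ∀ t ∈ I,
        Submodule.span ℝ {diracWeylVec (F t)} = Submodule.span ℝ {frameVec e 0 t} := by
      intro t ht
      refine Eq.trans ?_ (he.along t ht)
      rw [hF t ht]
      exact (Projectivization.submodule_mk _ _).symm
    have hc : ∃ c : ℝ → ℝ, ∀ t ∈ I, frameVec e 0 t = c t • diracWeylVec (F t) := by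
      have h1 : ∀ t, ∃ a : ℝ, t ∈ I → frameVec e 0 t = a • diracWeylVec (F t) := by
        intro t
        by_cases ht : t ∈ I
        · obtain ⟨a, ha⟩ := Submodule.mem_span_singleton.1
            ((hspan t ht).symm ▸ Submodule.mem_span_singleton_self (frameVec e 0 t))
          exact ⟨a, fun _ => ha.symm⟩
        · exact ⟨0, fun h => absurd h ht⟩
      choose c hc using h1
      exact ⟨c, hc⟩
    obtain ⟨c, hc⟩ := hc
    set p := centreComponent (fun t => ‖deriv F t‖) (curvatures k τ) with hp
    have hR : ∀ i, 1 ≤ i → ∀ t ∈ I, 0 < radiusSq p i t := fun i hi t ht =>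
      H.radiusSq_pos (by omega) ht hi
    refine ⟨sphereCentre F E p, fun i t => √(radiusSq p i t), fun i h1 h2 t ht =>
      isRoundSphere_osculatingSphere hn hI C hE hc hspan h1 (by omega) ht, ?_,
      contDiffOn_sphereCentre hn hI hE (by omega), ?_⟩
    · intro j hj hjn t ht
      obtain ⟨hr, hw⟩ := speed_eq_arclengthRatio hn hI C hE hc ht
      have hv := H.v_pos t ht
      have h1 := curvature_sq_mid hI C H hc ht hj (by omega)
      rw [← hp, curvatures, if_neg (by omega)] at h1
      have h2 := hR j (by omega) t ht
      -- The square root of the squared identity; genericity makes the left side nonnegative.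
      have h3 : frameForm e (j + 1) j t * radiusSq p j t =
          ‖deriv F t‖ * |τ (j + 1) t| * √(radiusSq p (j - 1) t) * √(radiusSq p (j + 1) t) := by
        refine (pow_left_inj₀ (mul_nonneg (he.generic t ht j hj (by omega)).le h2.le)
          (by positivity) two_ne_zero).1 ?_
        simp only [mul_pow, sq_abs, Real.sq_sqrt (hR (j - 1) (by omega) t ht).le,
          Real.sq_sqrt (hR (j + 1) (by omega) t ht).le]
        exact h1
      simp only [Real.sq_sqrt h2.le]
      rw [conformalCurvature, hw, div_eq_div_iff (by positivity) (by positivity)]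
      linear_combination arclengthRatio F k τ t * h3
    · intro t ht
      obtain ⟨hr, hw⟩ := speed_eq_arclengthRatio hn hI C hE hc ht
      have hv := H.v_pos t ht
      have h1 := curvature_sq_last hn hI C H hc ht
      have h2 := hR (n - 1) (by omega) t ht
      -- Here the sign of μ_{n-1} is free, so taking the root leaves an absolute value.
      have h3 : |frameForm e (n - 1 + 1) (n - 1) t| * radiusSq p (n - 1) t =
          ‖deriv F t‖ * |centreSpeed (fun t => ‖deriv F t‖) (curvatures k τ) n t| *
            √(radiusSq p (n - 2) t) := by
        refine (pow_left_inj₀ (by positivity) (by positivity) two_ne_zero).1 ?_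
        simp only [mul_pow, sq_abs, Real.sq_sqrt (hR (n - 2) (by omega) t ht).le]
        exact h1
      simp only [Real.sq_sqrt h2.le]
      rw [conformalCurvature, abs_div, abs_of_pos (he.immersed t ht), hw,
        norm_deriv_sphereCentre hn hI hE ht, mul_div_cancel_left₀ _ hv.ne',
        div_eq_div_iff (by positivity) (by positivity)]
      linear_combination arclengthRatio F k τ t * h3
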